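/- Let $d\ge 2$ and $T\ge 1$, let $\theta^\star\in\mathbb R^d$ with $\|\theta^\star\|_2=1$, $\sigma\ge 0$ and $\beta\in\mathbb R$. LinUCB with the unit ball $\mathcal B^d=\{b\in\mathbb R^d:\|b\|_2\le 1\}$ as action set runs as follows. For $0\le t\le T$ put $$\Lambda_t=I_d+\sum_{s=1}^t a_sa_s^\top,\qquad \overline\theta_t=\Lambda_t^{-1}\sum_{s=1}^t r_s a_s,\qquad \widehat\theta_t=\mathcal P(\overline\theta_t),$$ where $\mathcal P(x)=x/\|x\|_2$ for $x\ne 0$ and $\mathcal P(0)$ is any fixed vector of norm at most $1$. In round $t=1,\dots,T$ the action is $$a_t\in\arg\max_{b\in\mathcal B^d}\Big\{\langle b,\widehat\theta_{t-1}\rangle+\beta\sqrt{b^\top\Lambda_{t-1}^{-1}b}\Big\},$$ chosen $\mathcal F_{t-1}$-measurably with $\mathcal F_t=\sigma(a_1,r_1,\dots,a_t,r_t)$, and the reward is $r_t=\langle a_t,\theta^\star\rangle+\epsilon_t$, where for $1\le t\le T$ and all $l\in\mathbb R$ $$\mathbb E[\epsilon_t\mid\mathcal F_{t-1}]=0,\qquad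 \mathrm{Var}[\epsilon_t\mid\mathcal F_{t-1}]=\sigma^2,\qquad \mathbb E[e^{l\epsilon_t}\mid\mathcal F_{t-1}]\le e^{\sigma^2l^2/2}.$$ Assume that $\beta$ is at least the radius of the standard confidence ellipsoid at level $1-1/T$: $$\beta\ \ge\ \sigma\sqrt{d\log(1+T/d)+2\log T}+1 .$$ Let $\lambda_{t,1}\ge\dots\ge\lambda_{t,d}$ be the eigenvalues of $\Lambda_t$, let $\overline\lambda_t=\frac1{d-1}\sum_{i=2}^d\lambda_{t,i}$, and let $v_{t,1}$ denote a unit eigenvector for $\lambda_{t,1}$ with the sign chosen such that $\langle v_{t,1},\theta^\star\rangle\ge 0$. Then for every $\kappa>0$ there are constants $c,C>0$, depending only on $\kappa$ (and not on $d,T,\sigma,\beta,\theta^\star$ or the law of the noise), such that with probability greater than $1-1/T$ the following hold simultaneously for all integers $t$ with $\kappa\beta^2d\le t\le T$ (in particular for all $t_1\le t\le T$ whenever $t_1\ge\kappa\beta^2d$, as for the end $t_1=\Theta(\beta^2d)$ of the initial exploration phase): $$c\,\overline\lambda_t\le\lambda_{t,d}\le C\,\overline\lambda_t,\qquad c\,\beta\sqrt{t/d}\le\overline\lambda_t\le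 C\,\beta\sqrt{t/d},$$ and every such leading eigenvector satisfies $$\|v_{t,1}-\theta^\star\|_2\le C\,\frac{\beta}{\sqrt{\lambda_{t,d}}}.$$ -/

import Mathlib

open MeasureTheory ProbabilityTheory
open scoped Matrix

noncomputable section

namespace LinUCB

/-- `ℝ^d` with the Euclidean norm. -/
abbrev Vec (d : ℕ) : Type := EuclideanSpace ℝ (Fin d)

/-- The regularized cumulative covariance matrix `Λ_t = I + ∑_{s=1}^t a_s a_sᵀ` of a sequence of
actions `a_1, a_2, …` (the entry `a 0` is not used). -/
def cov {d : ℕ} (a : ℕ → Vec d) (t : ℕ) : Matrix (Fin d) (Fin d) ℝ :=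
  1 + ∑ s ∈ Finset.Icc 1 t, Matrix.vecMulVec (WithLp.ofLp (a s)) (WithLp.ofLp (a s))

theorem cov_isHermitian {d : ℕ} (a : ℕ → Vec d) (t : ℕ) : (cov a t).IsHermitian := by
  unfold cov Matrix.IsHermitian
  rw [Matrix.conjTranspose_add, Matrix.conjTranspose_sum, Matrix.conjTranspose_one]
  congr 1
  refine Finset.sum_congr rfl fun s _ => ?_
  ext i j
  simp [Matrix.vecMulVec_apply, mul_comm]

/-- The ridge estimator `θ̄_t = Λ_t⁻¹ ∑_{s=1}^t r_s a_s` (regularization parameter `1`). -/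
def ridge {d : ℕ} (a : ℕ → Vec d) (r : ℕ → ℝ) (t : ℕ) : Vec d :=
  WithLp.toLp 2 ((cov a t)⁻¹ *ᵥ ∑ s ∈ Finset.Icc 1 t, r s • WithLp.ofLp (a s))

open Classical in
/-- Projection onto the unit sphere, `x ↦ x / ‖x‖` for `x ≠ 0`. At the origin, where the projection
is not defined by this formula, it takes the prescribed value `e`. -/
def sphereProj {d : ℕ} (e x : Vec d) : Vec d :=
  if x = 0 then e else ‖x‖⁻¹ • x

/-- `UCB_t(b) = ⟨b, θ̂_{t-1}⟩ + β √(bᵀ Λ_{t-1}⁻¹ b)`, where `θ̂_{t-1}` is the projection of the ridge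
estimator onto the unit sphere. -/
def ucb {d : ℕ} (β : ℝ) (e : Vec d) (a : ℕ → Vec d) (r : ℕ → ℝ) (t : ℕ) (b : Vec d) : ℝ :=
  inner ℝ b (sphereProj e (ridge a r (t - 1))) +
    β * √(WithLp.ofLp b ⬝ᵥ ((cov a (t - 1))⁻¹ *ᵥ WithLp.ofLp b))

/-- `λ_{t,i}`, `1 ≤ i ≤ d`: the eigenvalues of `Λ_t` with multiplicity, in non-increasing order. -/
def eig {d : ℕ} (a : ℕ → Vec d) (t i : ℕ) : ℝ :=
  if h : 1 ≤ i ∧ i ≤ d then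
    (cov_isHermitian a t).eigenvalues₀ ⟨i - 1, by rw [Fintype.card_fin]; omega⟩
  else 0

/-- `λ̄_t`: the mean of the non-leading eigenvalues `λ_{t,2}, …, λ_{t,d}`. -/
def meanEig {d : ℕ} (a : ℕ → Vec d) (t : ℕ) : ℝ :=
  (∑ i ∈ Finset.Icc 2 d, eig a t i) / ((d : ℝ) - 1)

/-- `v` is a leading eigenvector `v_{t,1}` of `Λ_t`: a unit eigenvector for `λ_{t,1}`, with its sign
chosen such that `⟨v, θ⟩ ≥ 0`. -/
def IsLeadingEigenvector {d : ℕ} (θ : Vec d) (a : ℕ → Vec d) (t : ℕ) (v : Vec d) : Prop :=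
  ‖v‖ = 1 ∧ cov a t *ᵥ WithLp.ofLp v = eig a t 1 • WithLp.ofLp v ∧ 0 ≤ inner ℝ v θ

/-- `x ≍ y` with explicit constants: `c y ≤ x ≤ C y`. -/
def Comparable (c C x y : ℝ) : Prop := c * y ≤ x ∧ x ≤ C * y

/-- The natural filtration `ℱ_t = σ(a_1, r_1, …, a_t, r_t)`. -/
@[reducible] def hist {Ω : Type*} {d : ℕ} (a : ℕ → Ω → Vec d) (r : ℕ → Ω → ℝ) (t : ℕ) : MeasurableSpace Ω :=
  ⨆ s ∈ Finset.Icc 1 t, MeasurableSpace.comap (a s) inferInstance ⊔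
    MeasurableSpace.comap (r s) inferInstance

/-- The noise `ε_t = r_t - ⟨a_t, θ⟩`, that is, `r_t = ⟨a_t, θ⟩ + ε_t`. -/
def noise {Ω : Type*} {d : ℕ} (θ : Vec d) (a : ℕ → Ω → Vec d) (r : ℕ → Ω → ℝ) (t : ℕ) : Ω → ℝ :=
  fun ω => r t ω - inner ℝ (a t ω) θ

/-- `(a_t, r_t)_{1 ≤ t ≤ T}` are the actions and rewards of LinUCB with exploration parameter `β` on
the unit ball of `ℝ^d`, in the linear model with parameter `θ` and conditionally sub-Gaussian
martingale difference noise of conditional variance `σ²`. -/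
structure IsRun {Ω : Type*} [MeasurableSpace Ω] (P : Measure Ω) {d : ℕ} (T : ℕ) (β σ : ℝ)
    (θ e : Vec d) (a : ℕ → Ω → Vec d) (r : ℕ → Ω → ℝ) : Prop where
  measurable_action : ∀ t ∈ Finset.Icc 1 T, Measurable (a t)
  measurable_reward : ∀ t ∈ Finset.Icc 1 T, Measurable (r t)
  predictable : ∀ t ∈ Finset.Icc 1 T, Measurable[hist a r (t - 1)] (a t)
  action_mem : ∀ t ∈ Finset.Icc 1 T, ∀ ω, ‖a t ω‖ ≤ 1
  action_max : ∀ t ∈ Finset.Icc 1 T, ∀ ω, ∀ b : Vec d, ‖b‖ ≤ 1 →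
    ucb β e (fun s => a s ω) (fun s => r s ω) t b ≤
      ucb β e (fun s => a s ω) (fun s => r s ω) t (a t ω)
  noise_mean : ∀ t ∈ Finset.Icc 1 T, P[noise θ a r t | hist a r (t - 1)] =ᵐ[P] 0
  noise_var : ∀ t ∈ Finset.Icc 1 T,
    condVar (hist a r (t - 1)) (noise θ a r t) P =ᵐ[P] fun _ => σ ^ 2
  noise_exp_integrable : ∀ t ∈ Finset.Icc 1 T, ∀ l : ℝ,
    Integrable (fun ω => Real.exp (l * noise θ a r t ω)) P
  noise_subgaussian : ∀ t ∈ Finset.Icc 1 T, ∀ l : ℝ,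
    P[fun ω => Real.exp (l * noise θ a r t ω) | hist a r (t - 1)] ≤ᵐ[P]
      fun _ => Real.exp (σ ^ 2 * l ^ 2 / 2)

end LinUCB

end

/-!
On the event that every noise sum `S_t = ∑ ε_s a_s` has self-normalized size
`‖S_t‖_{Λ_t⁻¹} ≤ β - 1`, the ridge estimator and the action `a_{t+1}` lie within `O(β / √λ_{t,d})`
of `θ`. This event has probability more than `1 - 1/T` by Ville's inequality for the supermartingale
`exp (‖S_t‖²_{Λ_t⁻¹} / (2 σ²)) / √(det Λ_t)`, the Gaussian mixture of the exponential
supermartingales of the noise.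

Everything else happens along a single trajectory in this event. Since an action maximizes the
upper confidence bound, its squared norm in `Λ_t⁻¹` is at least of the order
`min (1 / λ_{t,d}) ((β / λ_{t,d})²)`, while the mean of the past actions, also close to `θ`,
has squared norm at most `1 / t`. The difference of the two is therefore carried by the directions
whose eigenvalue is at most some `ρ = O(λ_{t,d})`. Such mass is limited: it is taken from the trace
of `(ρ - 1 + Λ_t)⁻¹`, which starts at `d / ρ`. Hence `λ_{t,d}` is at least of the order
`min (t / d) (β √(t / d))`.

Summing `‖a_s - θ‖² = O(β² / λ_{s-1,d})` gives `∑ ‖a_s - θ‖² = O(d β √(t / d))`. This bounds the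
trace of `Λ_t` outside the leading direction, hence `λ̄_t`, and it bounds `t ‖v_{t,1} - θ‖²`,
because `v_{t,1}` and `θ` both carry all of `∑ ‖a_s‖²` up to this error.
-/

namespace LinUCB

section InverseCovariance

variable {E : Type*} [NormedAddCommGroup E] [InnerProductSpace ℝ E]

/-- The regularized covariance operator `ρ I + ∑_{s=1}^t a_s a_sᵀ`; for `ρ = 1` it is the operator
of the matrix `cov a t`. -/
noncomputable def covOp (ρ : ℝ) (a : ℕ → E) (t : ℕ) : E →ₗ[ℝ] E :=
  ρ • LinearMap.id + ∑ s ∈ Finset.Icc 1 t, (InnerProductSpace.rankOne ℝ (a s) (a s)).toLinearMap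

/-- The inverse of `covOp ρ a t`, which exists if `0 < ρ` and the space is finite-dimensional. -/
noncomputable def covInv (ρ : ℝ) (a : ℕ → E) (t : ℕ) : E →ₗ[ℝ] E :=
  Ring.inverse (covOp ρ a t)

variable {ρ : ℝ} {a : ℕ → E} {t : ℕ}

theorem covOp_apply (x : E) :
    covOp ρ a t x = ρ • x + ∑ s ∈ Finset.Icc 1 t, inner ℝ (a s) x • a s := by
  simp [covOp]

theorem covOp_succ_apply (x : E) :
    covOp ρ a (t + 1) x = covOp ρ a t x + inner ℝ (a (t + 1)) x • a (t + 1) := by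
  simp only [covOp_apply, Finset.sum_Icc_succ_top (Nat.le_add_left 1 t), add_assoc]

theorem covOp_eq_add (ρ' : ℝ) (x : E) : covOp ρ' a t x = covOp ρ a t x + (ρ' - ρ) • x := by
  rw [covOp_apply, covOp_apply, sub_smul]
  abel

theorem inner_covOp (x y : E) :
    inner ℝ x (covOp ρ a t y) =
      ρ * inner ℝ x y + ∑ s ∈ Finset.Icc 1 t, inner ℝ (a s) x * inner ℝ (a s) y := by
  simp only [covOp_apply, inner_add_right, inner_smul_right, inner_sum, real_inner_comm x, mul_comm]

theorem inner_covOp_self (x : E) :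
    inner ℝ x (covOp ρ a t x) = ρ * ‖x‖ ^ 2 + ∑ s ∈ Finset.Icc 1 t, inner ℝ (a s) x ^ 2 := by
  simp only [inner_covOp, real_inner_self_eq_norm_sq, sq]

theorem covOp_isSymmetric : (covOp ρ a t).IsSymmetric := fun x y => by
  rw [real_inner_comm, inner_covOp, inner_covOp, real_inner_comm]
  simp only [mul_comm]

theorem mul_norm_sq_le_inner_covOp (x : E) : ρ * ‖x‖ ^ 2 ≤ inner ℝ x (covOp ρ a t x) := by
  rw [inner_covOp_self]
  exact le_add_of_nonneg_right (Finset.sum_nonneg fun s _ => sq_nonneg _)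

variable [FiniteDimensional ℝ E]

theorem isUnit_covOp (hρ : 0 < ρ) : IsUnit (covOp ρ a t) := by
  refine (LinearMap.isUnit_iff_ker_eq_bot _).2 (LinearMap.ker_eq_bot'.2 fun x hx => ?_)
  have h := mul_norm_sq_le_inner_covOp (ρ := ρ) (a := a) (t := t) x
  rw [hx, inner_zero_right] at h
  simpa using nonpos_of_mul_nonpos_right h hρ

theorem covOp_covInv (hρ : 0 < ρ) (x : E) : covOp ρ a t (covInv ρ a t x) = x :=
  LinearMap.congr_fun (Ring.mul_inverse_cancel _ (isUnit_covOp hρ)) x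

theorem covInv_covOp (hρ : 0 < ρ) (x : E) : covInv ρ a t (covOp ρ a t x) = x :=
  LinearMap.congr_fun (Ring.inverse_mul_cancel _ (isUnit_covOp hρ)) x

theorem covInv_eq_iff (hρ : 0 < ρ) {x y : E} : covInv ρ a t x = y ↔ covOp ρ a t y = x := by
  constructor
  · rintro rfl
    exact covOp_covInv hρ x
  · rintro rfl
    exact covInv_covOp hρ y

theorem covInv_isPositive (hρ : 0 < ρ) : (covInv ρ a t).IsPositive := by
  have hsymm : (covInv ρ a t).IsSymmetric := fun x y => by
    conv_lhs => rw [← covOp_covInv (a := a) (t := t) hρ y, ← covOp_isSymmetric, covOp_covInv hρ]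
  refine ⟨hsymm, fun x => ?_⟩
  have h := mul_norm_sq_le_inner_covOp (ρ := ρ) (a := a) (t := t) (covInv ρ a t x)
  rw [covOp_covInv hρ] at h
  exact le_trans (by positivity) h

theorem covInv_eigenvector (hρ : 0 < ρ) {v : E} {l : ℝ} (hl : l ≠ 0) (h : covOp ρ a t v = l • v) :
    covInv ρ a t v = l⁻¹ • v := by
  rw [covInv_eq_iff hρ, map_smul, h, inv_smul_smul₀ hl]

theorem inner_covInv_le (hρ : 0 < ρ) {L : ℝ} (hL : 0 < L)
    (h : ∀ y, L * ‖y‖ ^ 2 ≤ inner ℝ y (covOp ρ a t y)) (x : E) :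
    inner ℝ x (covInv ρ a t x) ≤ ‖x‖ ^ 2 / L := by
  set y := covInv ρ a t x
  have hy : L * ‖y‖ ^ 2 ≤ inner ℝ x y := by
    rw [real_inner_comm, ← covOp_covInv (a := a) (t := t) hρ x]
    exact h y
  have hsq : 0 ≤ ‖x‖ ^ 2 - 2 * (L * inner ℝ x y) + L * (L * ‖y‖ ^ 2) := by
    calc 0 ≤ ‖x - L • y‖ ^ 2 := sq_nonneg _
      _ = _ := by
        rw [norm_sub_sq_real, real_inner_smul_right, norm_smul, mul_pow, Real.norm_eq_abs, sq_abs]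
        ring
  rw [le_div_iff₀ hL]
  linarith [mul_le_mul_of_nonneg_left hy hL.le]

theorem covInv_zero (hρ : 0 < ρ) (a : ℕ → E) : covInv ρ a 0 = ρ⁻¹ • LinearMap.id := by
  ext x
  rw [covInv_eq_iff hρ, covOp_apply]
  simp [smul_inv_smul₀ hρ.ne']

theorem covInv_succ (hρ : 0 < ρ) :
    covInv ρ a (t + 1) = covInv ρ a t -
      (1 + inner ℝ (a (t + 1)) (covInv ρ a t (a (t + 1))))⁻¹ •
        (InnerProductSpace.rankOne ℝ (covInv ρ a t (a (t + 1)))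
          (covInv ρ a t (a (t + 1)))).toLinearMap := by
  ext x
  set α := a (t + 1)
  set q : ℝ := inner ℝ α (covInv ρ a t α) with hq
  have hq0 : 0 ≤ q := (covInv_isPositive hρ).inner_nonneg_right α
  have hcomm : inner ℝ α (covInv ρ a t x) = inner ℝ (covInv ρ a t α) x :=
    ((covInv_isPositive hρ).isSymmetric α x).symm
  rw [covInv_eq_iff hρ, covOp_succ_apply]
  change covOp ρ a t (covInv ρ a t x - (1 + q)⁻¹ • inner ℝ (covInv ρ a t α) x • covInv ρ a t α) +
    inner ℝ α (covInv ρ a t x - (1 + q)⁻¹ • inner ℝ (covInv ρ a t α) x • covInv ρ a t α) • α = x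
  simp only [map_sub, map_smul, covOp_covInv hρ, inner_sub_right, inner_smul_right, hcomm, ← hq,
    smul_smul, sub_add, ← sub_smul]
  suffices h : (1 + q)⁻¹ * inner ℝ (covInv ρ a t α) x -
      (inner ℝ (covInv ρ a t α) x - (1 + q)⁻¹ * inner ℝ (covInv ρ a t α) x * q) = 0 by
    rw [h, zero_smul, sub_zero]
  field_simp
  ring

theorem inner_covInv_succ_self (hρ : 0 < ρ) (x : E) :
    inner ℝ x (covInv ρ a (t + 1) x) = inner ℝ x (covInv ρ a t x) -
      inner ℝ (a (t + 1)) (covInv ρ a t x) ^ 2 /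
        (1 + inner ℝ (a (t + 1)) (covInv ρ a t (a (t + 1)))) := by
  rw [covInv_succ hρ, ← (covInv_isPositive hρ).isSymmetric (a (t + 1)) x]
  simp only [LinearMap.sub_apply, LinearMap.smul_apply, ContinuousLinearMap.coe_coe,
    InnerProductSpace.rankOne_apply, inner_sub_right, inner_smul_right,
    real_inner_comm (covInv ρ a t (a (t + 1))) x]
  ring

/-- The trace of `covInv ρ a n` decreases by the `n`-th summand in step `n`. -/
theorem sum_norm_covInv_sq_div_le (hρ : 0 < ρ) (a : ℕ → E) (N : ℕ) :
    ∑ n ∈ Finset.range N, ‖covInv ρ a n (a (n + 1))‖ ^ 2 /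
      (1 + inner ℝ (a (n + 1)) (covInv ρ a n (a (n + 1)))) ≤ Module.finrank ℝ E / ρ := by
  have hstep : ∀ n, ‖covInv ρ a n (a (n + 1))‖ ^ 2 /
      (1 + inner ℝ (a (n + 1)) (covInv ρ a n (a (n + 1)))) =
      LinearMap.trace ℝ E (covInv ρ a n) - LinearMap.trace ℝ E (covInv ρ a (n + 1)) := fun n => by
    rw [covInv_succ hρ, map_sub, map_smul, InnerProductSpace.trace_rankOne,
      real_inner_self_eq_norm_sq, smul_eq_mul]
    ring
  rw [Finset.sum_congr rfl fun n _ => hstep n, Finset.sum_range_sub', covInv_zero hρ, map_smul,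
    LinearMap.trace_id, smul_eq_mul, inv_mul_eq_div]
  exact sub_le_self _ (covInv_isPositive hρ).trace_nonneg

/-- For `y := Λ_n⁻¹ m` with `m` the mean, `∑ ⟨a_s, y⟩ = n ⟨m, Λ_n⁻¹ m⟩` while
`∑ ⟨a_s, y⟩² ≤ ⟨m, Λ_n⁻¹ m⟩`; Cauchy–Schwarz compares the two. -/
theorem inner_covInv_mean_le (hρ : 0 < ρ) (a : ℕ → E) {n : ℕ} (hn : 1 ≤ n) :
    inner ℝ ((n : ℝ)⁻¹ • ∑ s ∈ Finset.Icc 1 n, a s)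
      (covInv ρ a n ((n : ℝ)⁻¹ • ∑ s ∈ Finset.Icc 1 n, a s)) ≤ 1 / (n : ℝ) := by
  set m := (n : ℝ)⁻¹ • ∑ s ∈ Finset.Icc 1 n, a s with hm
  set y := covInv ρ a n m with hy
  set q : ℝ := inner ℝ m y with hq
  have hn0 : (0 : ℝ) < n := by exact_mod_cast hn
  have hsum : ∑ s ∈ Finset.Icc 1 n, inner ℝ (a s) y = n * q := by
    rw [hq, hm, inner_smul_left, sum_inner, conj_trivial, mul_inv_cancel_left₀ hn0.ne']
  have hsq : ∑ s ∈ Finset.Icc 1 n, inner ℝ (a s) y ^ 2 ≤ q := by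
    have h := inner_covOp_self (ρ := ρ) (a := a) (t := n) y
    rw [hy, covOp_covInv hρ, ← hy, real_inner_comm] at h
    linarith [mul_nonneg hρ.le (sq_nonneg ‖y‖)]
  have hcs : (n * q) ^ 2 ≤ n * q := by
    have h := sq_sum_le_card_mul_sum_sq (s := Finset.Icc 1 n) (f := fun s => inner ℝ (a s) y)
    rw [hsum, Nat.card_Icc, Nat.add_sub_cancel] at h
    exact h.trans (by gcongr)
  rw [le_div_iff₀ hn0]
  nlinarith

end InverseCovariance

section Score

variable {E : Type*} [NormedAddCommGroup E] [InnerProductSpace ℝ E]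

/-- The weighted norm `‖x‖_V = √⟨x, V x⟩` of a positive operator `V`. -/
noncomputable def weightedNorm (V : E →ₗ[ℝ] E) (x : E) : ℝ := √(inner ℝ x (V x))

/-- The upper confidence bound `⟨b, w⟩ + β ‖b‖_V` on the reward of the action `b`, for an estimate
`w` of the parameter and the confidence weight `V`. -/
noncomputable def score (β : ℝ) (w : E) (V : E →ₗ[ℝ] E) (b : E) : ℝ :=
  inner ℝ b w + β * weightedNorm V b

variable {V : E →ₗ[ℝ] E} {β lam : ℝ} {v w α : E}

theorem weightedNorm_sq (hV : V.IsPositive) (x : E) : weightedNorm V x ^ 2 = inner ℝ x (V x) :=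
  Real.sq_sqrt (hV.inner_nonneg_right x)

theorem weightedNorm_nonneg (x : E) : 0 ≤ weightedNorm V x := Real.sqrt_nonneg _

theorem weightedNorm_smul (k : ℝ) (x : E) : weightedNorm V (k • x) = |k| * weightedNorm V x := by
  rw [weightedNorm, weightedNorm, map_smul, real_inner_smul_left, real_inner_smul_right,
    ← mul_assoc, Real.sqrt_mul (mul_self_nonneg k), Real.sqrt_mul_self_eq_abs]

theorem abs_inner_le_weightedNorm_mul (hV : V.IsPositive) (x y : E) :
    |inner ℝ x (V y)| ≤ weightedNorm V x * weightedNorm V y := by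
  have h := LinearMap.BilinForm.apply_sq_le_of_symm ((innerₗ E).compl₂ V)
    (fun x => hV.inner_nonneg_right x)
    ⟨fun x y => (real_inner_comm _ _).trans (hV.isSymmetric y x)⟩ x y
  rw [weightedNorm, weightedNorm, ← Real.sqrt_mul (hV.inner_nonneg_right x)]
  exact Real.abs_le_sqrt h

theorem weightedNorm_sq_add_smul (hV : V.IsPositive) (x y : E) (k : ℝ) :
    weightedNorm V (x + k • y) ^ 2 =
      weightedNorm V x ^ 2 + 2 * k * inner ℝ x (V y) + k ^ 2 * weightedNorm V y ^ 2 := by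
  simp only [weightedNorm_sq hV, map_add, map_smul, inner_add_left, inner_add_right,
    real_inner_smul_left, real_inner_smul_right, ← hV.isSymmetric y x, real_inner_comm x]
  ring

theorem weightedNorm_add_le (hV : V.IsPositive) (x y : E) :
    weightedNorm V (x + y) ≤ weightedNorm V x + weightedNorm V y := by
  refine abs_le_of_sq_le_sq' ?_ (add_nonneg (weightedNorm_nonneg x) (weightedNorm_nonneg y)) |>.2
  have h := weightedNorm_sq_add_smul hV x y 1
  rw [one_smul] at h
  linarith [le_of_abs_le (abs_inner_le_weightedNorm_mul hV x y)]

theorem eigenvalue_nonneg (hV : V.IsPositive) (hv : ‖v‖ = 1) (hlam : V v = lam • v) : 0 ≤ lam := by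
  have h := hV.inner_nonneg_right v
  rwa [hlam, real_inner_smul_right, real_inner_self_eq_norm_sq, hv, one_pow, mul_one] at h

theorem score_smul_of_nonneg {k : ℝ} (hk : 0 ≤ k) (b : E) :
    score β w V (k • b) = k * score β w V b := by
  rw [score, score, weightedNorm_smul, abs_of_nonneg hk, real_inner_smul_left]
  ring

theorem score_nonneg_of_isMaxOn (hmax : IsMaxOn (score β w V) (Metric.closedBall 0 1) α) :
    0 ≤ score β w V α := by
  have h := hmax (Metric.mem_closedBall_self zero_le_one)
  simpa [score, weightedNorm] using h

theorem score_le_mul_norm (hmax : IsMaxOn (score β w V) (Metric.closedBall 0 1) α) (b : E) :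
    score β w V b ≤ score β w V α * ‖b‖ := by
  rcases eq_or_ne b 0 with rfl | hb
  · simp [score, weightedNorm]
  have hb0 : 0 < ‖b‖ := norm_pos_iff.2 hb
  have h : score β w V (‖b‖⁻¹ • b) ≤ score β w V α :=
    hmax (by simp [norm_smul, inv_mul_cancel₀ hb0.ne'])
  rwa [score_smul_of_nonneg (by positivity), inv_mul_le_iff₀' hb0] at h

/-- Move from the maximizer in the direction `v` so far that its squared norm grows by `y`. -/
theorem mul_sqrt_sub_le_of_isMaxOn (hV : V.IsPositive) (hv : ‖v‖ = 1) (hlam : V v = lam • v)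
    (hα : ‖α‖ ≤ 1) (hmax : IsMaxOn (score β w V) (Metric.closedBall 0 1) α)
    (hvw : 0 ≤ inner ℝ v w) {y : ℝ} (hy : 0 ≤ y) :
    β * (√(weightedNorm V α ^ 2 + lam * y) - weightedNorm V α) ≤
      score β w V α * (√(1 + y) - 1) := by
  set p : ℝ := inner ℝ α v
  set x := √(p ^ 2 + y) - p
  have hx0 : 0 ≤ x := sub_nonneg.2 (Real.le_sqrt_of_sq_le (by linarith))
  have hx : x ^ 2 + 2 * x * p = y := by
    linear_combination Real.sq_sqrt (add_nonneg (sq_nonneg p) hy)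
  have hnorm : ‖α + x • v‖ ≤ √(1 + y) := by
    refine Real.le_sqrt_of_sq_le ?_
    rw [norm_add_sq_real, real_inner_smul_right, norm_smul, mul_pow, hv, Real.norm_eq_abs, sq_abs]
    nlinarith [norm_nonneg α]
  have hweight : weightedNorm V (α + x • v) = √(weightedNorm V α ^ 2 + lam * y) := by
    rw [← Real.sqrt_sq (weightedNorm_nonneg (α + x • v)), weightedNorm_sq_add_smul hV,
      weightedNorm_sq hV v, hlam, real_inner_smul_right, real_inner_smul_right,
      real_inner_self_eq_norm_sq, hv]
    congr 1
    linear_combination lam * hx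
  have h := (score_le_mul_norm hmax (α + x • v)).trans
    (mul_le_mul_of_nonneg_left hnorm (score_nonneg_of_isMaxOn hmax))
  have hmove : score β w V (α + x • v) = score β w V α + x * inner ℝ v w +
      β * (√(weightedNorm V α ^ 2 + lam * y) - weightedNorm V α) := by
    rw [score, score, hweight, inner_add_left, real_inner_smul_left]
    ring
  linarith [mul_nonneg hx0 hvw]

/-- First-order optimality: let `y` tend to zero in `mul_sqrt_sub_le_of_isMaxOn`. -/
theorem mul_eigenvalue_le_score_mul_weightedNorm (hV : V.IsPositive) (hv : ‖v‖ = 1)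
    (hlam : V v = lam • v) (hα : ‖α‖ ≤ 1)
    (hmax : IsMaxOn (score β w V) (Metric.closedBall 0 1) α) :
    β * lam ≤ score β w V α * weightedNorm V α := by
  wlog hvw : 0 ≤ inner ℝ v w generalizing v
  · refine this (v := -v) (by rwa [norm_neg]) (by rw [map_neg, hlam, smul_neg]) ?_
    rw [inner_neg_left]
    linarith
  set s := weightedNorm V α
  set μ := score β w V α
  have hs : 0 ≤ s := weightedNorm_nonneg α
  have hlam0 := eigenvalue_nonneg hV hv hlam
  have hbound : ∀ y > 0, 2 * (β * lam) ≤ μ * (√(s ^ 2 + lam * y) + s) := fun y hy => by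
    have hroot : (√(s ^ 2 + lam * y) - s) * (√(s ^ 2 + lam * y) + s) = lam * y := by
      linear_combination Real.sq_sqrt (add_nonneg (sq_nonneg s) (mul_nonneg hlam0 hy.le))
    have hone : √(1 + y) - 1 ≤ y / 2 := by
      rw [sub_le_iff_le_add, Real.sqrt_le_left (by positivity)]
      nlinarith
    have h := (mul_sqrt_sub_le_of_isMaxOn hV hv hlam hα hmax hvw hy.le).trans
      (mul_le_mul_of_nonneg_left hone (score_nonneg_of_isMaxOn hmax))
    have h' : β * (lam * y) ≤ μ * (y / 2) * (√(s ^ 2 + lam * y) + s) := by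
      calc β * (lam * y) = β * (√(s ^ 2 + lam * y) - s) * (√(s ^ 2 + lam * y) + s) := by
            rw [mul_assoc, hroot]
        _ ≤ μ * (y / 2) * (√(s ^ 2 + lam * y) + s) :=
          mul_le_mul_of_nonneg_right h (by positivity)
    exact le_of_mul_le_mul_right (by linarith) hy
  have hlim : Filter.Tendsto (fun y => μ * (√(s ^ 2 + lam * y) + s)) (nhdsWithin 0 (Set.Ioi 0))
      (nhds (μ * (√(s ^ 2 + lam * 0) + s))) :=
    (Continuous.tendsto (by fun_prop) 0).mono_left nhdsWithin_le_nhds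
  have h := ge_of_tendsto hlim (eventually_mem_nhdsWithin.mono hbound)
  rw [mul_zero, add_zero, Real.sqrt_sq hs] at h
  linarith

theorem weightedNorm_sq_ge_of_isMaxOn (hV : V.IsPositive) (hβ : 0 < β) (hv : ‖v‖ = 1)
    (hlam : V v = lam • v) (hw : ‖w‖ ≤ 1) (hα : ‖α‖ ≤ 1)
    (hmax : IsMaxOn (score β w V) (Metric.closedBall 0 1) α) :
    lam / 2 ≤ weightedNorm V α ^ 2 ∨ (β * lam / 2) ^ 2 ≤ weightedNorm V α ^ 2 := by
  have h := mul_eigenvalue_le_score_mul_weightedNorm hV hv hlam hα hmax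
  set s := weightedNorm V α
  have hs : 0 ≤ s := weightedNorm_nonneg α
  have hscore : score β w V α ≤ 1 + β * s :=
    add_le_add_left ((real_inner_le_norm α w).trans (mul_le_one₀ hα (norm_nonneg w) hw)) _
  rcases le_total 1 (β * s) with h1 | h1
  · left
    have h2 : β * lam ≤ β * (2 * s ^ 2) := by nlinarith
    linarith [le_of_mul_le_mul_left h2 hβ]
  · right
    have hlam0 := eigenvalue_nonneg hV hv hlam
    have h2 : β * lam / 2 ≤ s := by nlinarith
    gcongr

theorem norm_sub_le_of_isMaxOn (hV : V.IsPositive) (hβ : 0 ≤ β) {K : ℝ}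
    (hK : ∀ x, weightedNorm V x ≤ K * ‖x‖) (hw : ‖w‖ = 1) (hα : ‖α‖ ≤ 1)
    (hmax : IsMaxOn (score β w V) (Metric.closedBall 0 1) α) : ‖α - w‖ ≤ 2 * β * K := by
  have hK0 : 0 ≤ K := by simpa [hw] using (weightedNorm_nonneg w).trans (hK w)
  have hscore : score β w V w ≤ score β w V α := hmax (by simp [hw])
  rw [score, score, real_inner_self_eq_norm_sq, hw] at hscore
  have htri := weightedNorm_add_le hV (α - w) w
  rw [sub_add_cancel] at htri
  have hsq : ‖α - w‖ ^ 2 ≤ 2 * β * K * ‖α - w‖ := by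
    have hlin : ‖α - w‖ ^ 2 ≤ 2 - 2 * inner ℝ α w := by
      rw [norm_sub_sq_real, hw]
      nlinarith [norm_nonneg α]
    nlinarith [hK (α - w)]
  rcases (norm_nonneg (α - w)).eq_or_lt with h0 | h0
  · rw [← h0]
    positivity
  · rw [sq] at hsq
    exact le_of_mul_le_mul_right hsq h0

end Score

section Eigenbasis

variable {E ι : Type*} [NormedAddCommGroup E] [InnerProductSpace ℝ E] [Fintype ι]
  {b : OrthonormalBasis ι ℝ E} {l : ι → ℝ} {A : E →ₗ[ℝ] E}

theorem inner_eigenbasis_apply (hb : ∀ i, A (b i) = l i • b i) (i : ι) (x : E) :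
    inner ℝ (b i) (A x) = l i * inner ℝ (b i) x := by
  classical
  conv_lhs => rw [← b.sum_repr' x]
  simp only [map_sum, map_smul, hb, inner_sum, inner_smul_right, b.inner_eq_ite, mul_ite, mul_one,
    mul_zero, Finset.sum_ite_eq, Finset.mem_univ, if_true, mul_comm (l i)]

theorem inner_apply_self_eq_sum (hb : ∀ i, A (b i) = l i • b i) (x : E) :
    inner ℝ x (A x) = ∑ i, l i * inner ℝ (b i) x ^ 2 := by
  rw [← b.sum_inner_mul_inner x (A x)]
  refine Finset.sum_congr rfl fun i _ => ?_
  rw [inner_eigenbasis_apply hb, real_inner_comm]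
  ring

theorem norm_apply_sq_eq_sum (hb : ∀ i, A (b i) = l i • b i) (x : E) :
    ‖A x‖ ^ 2 = ∑ i, l i ^ 2 * inner ℝ (b i) x ^ 2 := by
  simp only [← b.sum_sq_inner_right, inner_eigenbasis_apply hb, mul_pow]

/-- The mass `∑ ⟨b_i, x⟩²` of `x` on the vectors of the eigenbasis `b` whose eigenvalue `l_i` is at
most `ρ`: it measures how much an action `x` explores the poorly known directions. -/
noncomputable def lowMass (b : OrthonormalBasis ι ℝ E) (l : ι → ℝ) (ρ : ℝ) (x : E) : ℝ :=
  ∑ i with l i ≤ ρ, inner ℝ (b i) x ^ 2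

theorem monotone_lowMass (b : OrthonormalBasis ι ℝ E) (l : ι → ℝ) (x : E) :
    Monotone fun ρ => lowMass b l ρ x := fun _ _ h =>
  Finset.sum_le_sum_of_subset_of_nonneg
    (Finset.monotone_filter_right _ fun _ _ hi => le_trans hi h) fun _ _ _ => sq_nonneg _

theorem lowMass_nonneg (b : OrthonormalBasis ι ℝ E) (l : ι → ℝ) (ρ : ℝ) (x : E) :
    0 ≤ lowMass b l ρ x :=
  Finset.sum_nonneg fun _ _ => sq_nonneg _

variable [FiniteDimensional ℝ E] {ρ : ℝ} {a : ℕ → E} {t : ℕ}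

/-- Directions with eigenvalue larger than `ρ` contribute to `⟨x, Λ_t⁻¹ x⟩` only through a reference
point `m`, up to an error `‖x - m‖² / ρ`. -/
theorem inner_covInv_le_lowMass_add {L : ℝ} (hL : 0 < L) (hl : ∀ i, L ≤ l i)
    (hb : ∀ i, covOp 1 a t (b i) = l i • b i) (hρ : 0 < ρ) (x m : E) :
    inner ℝ x (covInv 1 a t x) ≤ lowMass b l ρ x / L + 2 * inner ℝ m (covInv 1 a t m) +
      2 * (‖x - m‖ ^ 2 / ρ) := by
  have hinv (i : ι) : covInv 1 a t (b i) = (l i)⁻¹ • b i :=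
    covInv_eigenvector one_pos (hL.trans_le (hl i)).ne' (hb i)
  rw [inner_apply_self_eq_sum hinv, inner_apply_self_eq_sum hinv, ← b.sum_sq_inner_right (x - m),
    lowMass, Finset.sum_filter, Finset.sum_div, Finset.sum_div, Finset.mul_sum, Finset.mul_sum,
    ← Finset.sum_add_distrib, ← Finset.sum_add_distrib]
  refine Finset.sum_le_sum fun i _ => ?_
  have hli : 0 < l i := hL.trans_le (hl i)
  rw [inner_sub_right]
  set p : ℝ := inner ℝ (b i) x
  set q : ℝ := inner ℝ (b i) m
  split_ifs with hi
  · calc (l i)⁻¹ * p ^ 2 ≤ L⁻¹ * p ^ 2 := by gcongr; exact hl i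
      _ = p ^ 2 / L := inv_mul_eq_div _ _
      _ ≤ p ^ 2 / L + 2 * ((l i)⁻¹ * q ^ 2) + 2 * ((p - q) ^ 2 / ρ) := by
        rw [add_assoc]
        exact le_add_of_nonneg_right (by positivity)
  · have hsq : p ^ 2 ≤ 2 * q ^ 2 + 2 * (p - q) ^ 2 := by linarith [sq_nonneg (p - 2 * q)]
    calc (l i)⁻¹ * p ^ 2 ≤ (l i)⁻¹ * (2 * q ^ 2 + 2 * (p - q) ^ 2) := by gcongr
      _ = 2 * ((l i)⁻¹ * q ^ 2) + 2 * ((p - q) ^ 2 / l i) := by ring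
      _ ≤ 0 / L + 2 * ((l i)⁻¹ * q ^ 2) + 2 * ((p - q) ^ 2 / ρ) := by
        rw [zero_div, zero_add]
        gcongr
        exact (not_le.1 hi).le

theorem lowMass_div_le (hb : ∀ i, covOp 1 a t (b i) = l i • b i) (hρ : 1 ≤ ρ) {x : E}
    (hx : ‖x‖ ≤ 1) :
    lowMass b l ρ x / (8 * ρ ^ 2) ≤ ‖covInv ρ a t x‖ ^ 2 / (1 + inner ℝ x (covInv ρ a t x)) := by
  have hρ0 : 0 < ρ := one_pos.trans_le hρ
  have hl (i : ι) : 1 ≤ l i := by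
    simpa [hb, real_inner_smul_right] using
      mul_norm_sq_le_inner_covOp (ρ := 1) (a := a) (t := t) (b i)
  have hinv (i : ι) : covInv ρ a t (b i) = (l i + (ρ - 1))⁻¹ • b i := by
    refine covInv_eigenvector hρ0 (by linarith [hl i]) ?_
    rw [covOp_eq_add (ρ := 1), hb, add_smul]
  have hmass : lowMass b l ρ x / (4 * ρ ^ 2) ≤ ‖covInv ρ a t x‖ ^ 2 := by
    rw [norm_apply_sq_eq_sum hinv, lowMass, Finset.sum_div]
    refine le_trans (Finset.sum_le_sum fun i hi => ?_)
      (Finset.sum_le_univ_sum_of_nonneg (s := {i | l i ≤ ρ}) fun i => by positivity)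
    have hi' : l i + (ρ - 1) ≤ 2 * ρ := by linarith [(Finset.mem_filter.1 hi).2]
    have h0 : 0 < l i + (ρ - 1) := by linarith [hl i]
    calc inner ℝ (b i) x ^ 2 / (4 * ρ ^ 2) = ((2 * ρ)⁻¹) ^ 2 * inner ℝ (b i) x ^ 2 := by
          field_simp
          norm_num
      _ ≤ (l i + (ρ - 1))⁻¹ ^ 2 * inner ℝ (b i) x ^ 2 := by gcongr
  have hle : inner ℝ x (covInv ρ a t x) ≤ 1 := by
    refine (inner_covInv_le hρ0 hρ0 mul_norm_sq_le_inner_covOp x).trans ((div_le_one₀ hρ0).2 ?_)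
    exact (pow_le_one₀ (norm_nonneg x) hx).trans hρ
  have hnonneg := (covInv_isPositive (a := a) (t := t) hρ0).inner_nonneg_right x
  calc lowMass b l ρ x / (8 * ρ ^ 2) = lowMass b l ρ x / (4 * ρ ^ 2) / 2 := by ring
    _ ≤ ‖covInv ρ a t x‖ ^ 2 / 2 := by gcongr
    _ ≤ ‖covInv ρ a t x‖ ^ 2 / (1 + inner ℝ x (covInv ρ a t x)) := by gcongr; linarith

theorem sum_lowMass_le {b : ℕ → OrthonormalBasis ι ℝ E} {l : ℕ → ι → ℝ}
    (hb : ∀ n i, covOp 1 a n (b n i) = l n i • b n i) (hρ : 1 ≤ ρ) {N : ℕ}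
    (ha : ∀ n < N, ‖a (n + 1)‖ ≤ 1) :
    ∑ n ∈ Finset.range N, lowMass (b n) (l n) ρ (a (n + 1)) ≤ 8 * ρ * Module.finrank ℝ E := by
  have hρ0 : 0 < ρ := one_pos.trans_le hρ
  have h := (Finset.sum_le_sum fun n hn => lowMass_div_le (hb n) hρ
    (ha n (Finset.mem_range.1 hn))).trans (sum_norm_covInv_sq_div_le hρ0 a N)
  rw [← Finset.sum_div, div_le_div_iff₀ (by positivity) hρ0] at h
  refine le_of_mul_le_mul_right (h.trans_eq ?_) hρ0
  ring

end Eigenbasis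

section CovarianceMatrix

variable {d : ℕ} {a : ℕ → Vec d} {t : ℕ}

theorem toEuclideanLin_cov (a : ℕ → Vec d) (t : ℕ) :
    Matrix.toEuclideanLin (cov a t) = covOp 1 a t := by
  ext x : 1
  simp only [cov, covOp_apply, map_add, map_sum, Matrix.toLpLin_one, LinearMap.add_apply,
    LinearMap.sum_apply, LinearMap.id_apply, one_smul]
  congr 1
  refine Finset.sum_congr rfl fun s _ => ?_
  ext j
  simp [Matrix.vecMulVec_mulVec, EuclideanSpace.inner_eq_star_dotProduct, dotProduct_comm, mul_comm]

theorem isUnit_det_cov (a : ℕ → Vec d) (t : ℕ) : IsUnit (cov a t).det := by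
  rw [← Matrix.isUnit_iff_isUnit_det, ← MulEquiv.isUnit_map (Matrix.toLpLinAlgEquiv (R := ℝ) 2)]
  exact toEuclideanLin_cov a t ▸ isUnit_covOp one_pos

theorem toEuclideanLin_cov_inv (a : ℕ → Vec d) (t : ℕ) :
    Matrix.toEuclideanLin (cov a t)⁻¹ = covInv 1 a t := by
  ext x : 1
  rw [eq_comm, covInv_eq_iff one_pos, ← toEuclideanLin_cov, ← LinearMap.comp_apply,
    ← Matrix.toLpLin_mul_same, Matrix.mul_nonsing_inv _ (isUnit_det_cov a t), Matrix.toLpLin_one,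
    LinearMap.id_apply]

theorem inner_covInv_eq_dotProduct (a : ℕ → Vec d) (t : ℕ) (x y : Vec d) :
    inner ℝ x (covInv 1 a t y) = x.ofLp ⬝ᵥ ((cov a t)⁻¹ *ᵥ y.ofLp) := by
  rw [← toEuclideanLin_cov_inv, EuclideanSpace.inner_eq_star_dotProduct, dotProduct_comm]
  simp

theorem ucb_eq_score (β : ℝ) (e : Vec d) (a : ℕ → Vec d) (r : ℕ → ℝ) (t : ℕ) :
    ucb β e a r t = score β (sphereProj e (ridge a r (t - 1))) (covInv 1 a (t - 1)) := by
  ext b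
  rw [ucb, score, weightedNorm, inner_covInv_eq_dotProduct]

theorem ridge_eq_covInv (a : ℕ → Vec d) (r : ℕ → ℝ) (t : ℕ) :
    ridge a r t = covInv 1 a t (∑ s ∈ Finset.Icc 1 t, r s • a s) := by
  rw [ridge, ← toEuclideanLin_cov_inv, Matrix.toLpLin_apply]
  simp

/-- An orthonormal basis of eigenvectors of `Λ_t`, in non-increasing order of the eigenvalues; since
`Fin d` starts at `0`, the `i`-th vector belongs to the eigenvalue `eig a t (i + 1)`. -/
noncomputable def eigBasis (a : ℕ → Vec d) (t : ℕ) : OrthonormalBasis (Fin d) ℝ (Vec d) :=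
  (cov_isHermitian a t).eigenvectorBasis.reindex
    ((Fintype.equivOfCardEq (Fintype.card_fin _)).symm.trans (finCongr (Fintype.card_fin d)))

theorem eig_coe_add_one (a : ℕ → Vec d) (t : ℕ) (i : Fin d) :
    eig a t (i + 1) =
      (cov_isHermitian a t).eigenvalues₀ (finCongr (Fintype.card_fin d).symm i) := by
  rw [eig, dif_pos ⟨by lia, by lia⟩]
  rfl

theorem covOp_eigBasis (a : ℕ → Vec d) (t : ℕ) (i : Fin d) :
    covOp 1 a t (eigBasis a t i) = eig a t (i + 1) • eigBasis a t i := by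
  have h := (cov_isHermitian a t).mulVec_eigenvectorBasis
    (Fintype.equivOfCardEq (Fintype.card_fin _) (finCongr (Fintype.card_fin d).symm i))
  rw [Matrix.IsHermitian.eigenvalues, Equiv.symm_apply_apply, ← eig_coe_add_one] at h
  rw [eigBasis, OrthonormalBasis.reindex_apply, ← toEuclideanLin_cov]
  ext j
  simpa using congrFun h j

theorem eig_antitoneOn (a : ℕ → Vec d) (t : ℕ) : AntitoneOn (eig a t) (Set.Icc 1 d) := by
  rintro i ⟨hi, hid⟩ j ⟨hj, hjd⟩ hij
  rw [eig, eig, dif_pos ⟨hj, hjd⟩, dif_pos ⟨hi, hid⟩]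
  exact (cov_isHermitian a t).eigenvalues₀_antitone (Nat.sub_le_sub_right hij 1)

theorem eig_last_le (i : Fin d) : eig a t d ≤ eig a t (i + 1) :=
  eig_antitoneOn a t ⟨by lia, i.2⟩ ⟨i.pos, le_rfl⟩ i.2

theorem sum_eig_eq_sum_fin (a : ℕ → Vec d) (t : ℕ) :
    ∑ i ∈ Finset.Icc 1 d, eig a t i = ∑ i : Fin d, eig a t (i + 1) := by
  rw [Fin.sum_univ_eq_sum_range (fun i => eig a t (i + 1)), Finset.range_eq_Ico,
    Finset.sum_Ico_add' (fun i => eig a t i)]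
  rfl

theorem inner_eigBasis_covOp (a : ℕ → Vec d) (t : ℕ) (i : Fin d) :
    inner ℝ (eigBasis a t i) (covOp 1 a t (eigBasis a t i)) = eig a t (i + 1) := by
  simp [covOp_eigBasis, real_inner_smul_right]

theorem sum_eig (a : ℕ → Vec d) (t : ℕ) :
    ∑ i ∈ Finset.Icc 1 d, eig a t i = d + ∑ s ∈ Finset.Icc 1 t, ‖a s‖ ^ 2 := by
  rw [sum_eig_eq_sum_fin, Finset.sum_congr rfl fun i _ => (inner_eigBasis_covOp a t i).symm,
    ← LinearMap.trace_eq_sum_inner]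
  simp only [covOp, map_add, map_sum, LinearMap.trace_id, finrank_euclideanSpace_fin,
    InnerProductSpace.trace_rankOne, real_inner_self_eq_norm_sq, one_smul]

theorem eig_last_mul_norm_sq_le (a : ℕ → Vec d) (t : ℕ) (x : Vec d) :
    eig a t d * ‖x‖ ^ 2 ≤ inner ℝ x (covOp 1 a t x) := by
  rw [inner_apply_self_eq_sum (covOp_eigBasis a t), ← (eigBasis a t).sum_sq_inner_right,
    Finset.mul_sum]
  gcongr with i
  exact eig_last_le i

theorem inner_covOp_le_eig_one_mul_norm_sq (a : ℕ → Vec d) (t : ℕ) (x : Vec d) :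
    inner ℝ x (covOp 1 a t x) ≤ eig a t 1 * ‖x‖ ^ 2 := by
  rw [inner_apply_self_eq_sum (covOp_eigBasis a t), ← (eigBasis a t).sum_sq_inner_right,
    Finset.mul_sum]
  gcongr with i
  exact eig_antitoneOn a t ⟨le_rfl, i.pos⟩ ⟨by lia, i.2⟩ (by lia)

theorem inner_eigBasis_last (hd : 1 ≤ d) (a : ℕ → Vec d) (t : ℕ) :
    inner ℝ (eigBasis a t ⟨d - 1, by lia⟩) (covOp 1 a t (eigBasis a t ⟨d - 1, by lia⟩)) =
      eig a t d := by
  rw [inner_eigBasis_covOp, Nat.sub_add_cancel hd]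

theorem one_le_eig_last (hd : 1 ≤ d) (a : ℕ → Vec d) (t : ℕ) : 1 ≤ eig a t d := by
  have h := mul_norm_sq_le_inner_covOp (ρ := 1) (a := a) (t := t) (eigBasis a t ⟨d - 1, by lia⟩)
  rwa [inner_eigBasis_last hd, OrthonormalBasis.norm_eq_one, one_pow, mul_one] at h

theorem monotone_eig_last (hd : 1 ≤ d) (a : ℕ → Vec d) : Monotone fun t => eig a t d := by
  refine monotone_nat_of_le_succ fun t => ?_
  set v := eigBasis a (t + 1) ⟨d - 1, by lia⟩ with hv
  calc eig a t d = eig a t d * ‖v‖ ^ 2 := by rw [OrthonormalBasis.norm_eq_one, one_pow, mul_one]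
    _ ≤ inner ℝ v (covOp 1 a t v) := eig_last_mul_norm_sq_le a t v
    _ ≤ inner ℝ v (covOp 1 a (t + 1) v) := by
      rw [covOp_succ_apply, inner_add_right, real_inner_smul_right, real_inner_comm v]
      exact le_add_of_nonneg_right (mul_self_nonneg _)
    _ = eig a (t + 1) d := by rw [hv, inner_eigBasis_last hd]

theorem weightedNorm_covInv_le (hd : 1 ≤ d) (a : ℕ → Vec d) (t : ℕ) (x : Vec d) :
    weightedNorm (covInv 1 a t) x ≤ (√(eig a t d))⁻¹ * ‖x‖ := by
  have hL : 0 < eig a t d := one_pos.trans_le (one_le_eig_last hd a t)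
  rw [inv_mul_eq_div, weightedNorm, ← Real.sqrt_sq (norm_nonneg x), ← Real.sqrt_div (sq_nonneg _)]
  exact Real.sqrt_le_sqrt (inner_covInv_le one_pos hL (eig_last_mul_norm_sq_le a t) x)

theorem eig_last_le_meanEig (hd : 2 ≤ d) (a : ℕ → Vec d) (t : ℕ) : eig a t d ≤ meanEig a t := by
  have hd1 : (0 : ℝ) < (d : ℝ) - 1 := by
    have : (2 : ℝ) ≤ d := by exact_mod_cast hd
    linarith
  have h := Finset.card_nsmul_le_sum (Finset.Icc 2 d) (eig a t) (eig a t d) fun i hi => by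
    rw [Finset.mem_Icc] at hi
    exact eig_antitoneOn a t ⟨by lia, hi.2⟩ ⟨by lia, le_rfl⟩ hi.2
  rw [nsmul_eq_mul, Nat.card_Icc, Nat.cast_sub (by lia)] at h
  rw [meanEig, le_div_iff₀ hd1]
  push_cast at h
  linarith

end CovarianceMatrix

section Growth

/-- The order `min (t / d) (β √(t / d))` of the smallest eigenvalue after `t` rounds, as a function
of `y = t / d`. -/
noncomputable def growth (β y : ℝ) : ℝ := min y (β * √y)

variable {β y : ℝ}

theorem growth_nonneg (hβ : 0 ≤ β) (hy : 0 ≤ y) : 0 ≤ growth β y :=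
  le_min hy (by positivity)

theorem growth_le_self (β y : ℝ) : growth β y ≤ y := min_le_left _ _

theorem monotone_growth (hβ : 0 ≤ β) : Monotone (growth β) := fun x y h => by
  unfold growth
  gcongr

theorem growth_mul_le (hβ : 0 ≤ β) {μ : ℝ} (hμ : 1 ≤ μ) (y : ℝ) :
    growth β (μ * y) ≤ μ * growth β y := by
  have hμ0 : 0 ≤ μ := zero_le_one.trans hμ
  rw [growth, growth, mul_min_of_nonneg _ _ hμ0, Real.sqrt_mul hμ0, mul_left_comm]
  gcongr
  exact Real.sqrt_le_self_iff.2 (Or.inr hμ)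

theorem growth_sq_le (hβ : 0 ≤ β) (hy : 0 ≤ y) : growth β y ^ 2 ≤ β ^ 2 * y := by
  calc growth β y ^ 2 ≤ (β * √y) ^ 2 := by
        gcongr
        · exact growth_nonneg hβ hy
        · exact min_le_right _ _
    _ = β ^ 2 * y := by rw [mul_pow, Real.sq_sqrt hy]

theorem sum_Icc_le_of_mul_sqrt_le {x : ℕ → ℝ} {K : ℝ} {n : ℕ} (hK : 0 ≤ K)
    (h : ∀ s ∈ Finset.Icc 1 n, x s * √s ≤ K) : ∑ s ∈ Finset.Icc 1 n, x s ≤ 2 * K * √n := by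
  induction n with
  | zero => simp
  | succ n ih =>
    rw [Finset.sum_Icc_succ_top (by lia)]
    have hsqrt : 0 < √((n + 1 : ℕ) : ℝ) := Real.sqrt_pos.2 (by positivity)
    have hmul : 1 ≤ 2 * (√((n + 1 : ℕ) : ℝ) - √n) * √((n + 1 : ℕ) : ℝ) := by
      have h1 : √((n + 1 : ℕ) : ℝ) ^ 2 = n + 1 := by
        rw [Real.sq_sqrt (by positivity), Nat.cast_add_one]
      have h2 : √(n : ℝ) ^ 2 = n := Real.sq_sqrt (by positivity)
      linarith [sq_nonneg (√((n + 1 : ℕ) : ℝ) - √n)]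
    have hlast : x (n + 1) ≤ 2 * K * (√((n + 1 : ℕ) : ℝ) - √n) := by
      refine le_of_mul_le_mul_right ((h _ (Finset.right_mem_Icc.2 (by lia))).trans ?_) hsqrt
      linarith [mul_le_mul_of_nonneg_left hmul hK]
    linarith [ih fun s hs => h s (Finset.Icc_subset_Icc_right n.le_succ hs)]

end Growth

section OptimisticRun

/-- The properties of a trajectory on the confidence event that determine the spectrum of `Λ_t`:
each action maximizes an optimistic score for some estimate in the unit ball, and lies within the
confidence radius of `θ`. -/
structure IsOptimistic {d : ℕ} (β : ℝ) (θ : Vec d) (a : ℕ → Vec d) (T : ℕ) : Prop where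
  norm_le : ∀ n < T, ‖a (n + 1)‖ ≤ 1
  maximizes : ∀ n < T, ∃ w : Vec d, ‖w‖ ≤ 1 ∧
    IsMaxOn (score β w (covInv 1 a n)) (Metric.closedBall 0 1) (a (n + 1))
  dist_le : ∀ n < T, ‖a (n + 1) - θ‖ ≤ 4 * β / √(eig a n d)

variable {d : ℕ} {β : ℝ} {θ : Vec d} {a : ℕ → Vec d} {T n : ℕ}

theorem IsOptimistic.norm_sub_sq_mul_le (ho : IsOptimistic β θ a T) (hd : 1 ≤ d) (hn : n < T) :
    ‖a (n + 1) - θ‖ ^ 2 * eig a n d ≤ 16 * β ^ 2 := by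
  have hL : 0 < eig a n d := one_pos.trans_le (one_le_eig_last hd a n)
  rw [← le_div_iff₀ hL]
  calc ‖a (n + 1) - θ‖ ^ 2 ≤ (4 * β / √(eig a n d)) ^ 2 := by gcongr; exact ho.dist_le n hn
    _ = 16 * β ^ 2 / eig a n d := by rw [div_pow, Real.sq_sqrt hL.le]; ring

theorem half_growth_succ_le_eig_last (hd : 1 ≤ d) (hβ : 0 ≤ β) {c : ℝ} (hc0 : 0 ≤ c) (hc : c ≤ 1)
    (h : c * growth β (n / d) ≤ eig a n d) :
    c / 2 * growth β ((n + 1 : ℕ) / d) ≤ eig a n d := by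
  rcases n.eq_zero_or_pos with rfl | hn
  · have hgrowth : growth β ((0 + 1 : ℕ) / d) ≤ 1 := by
      refine (growth_le_self _ _).trans (div_le_one_of_le₀ ?_ d.cast_nonneg)
      exact_mod_cast hd
    calc c / 2 * growth β ((0 + 1 : ℕ) / d) ≤ c / 2 * 1 := by gcongr
      _ ≤ 1 := by linarith
      _ ≤ eig a 0 d := one_le_eig_last hd a 0
  · have hn1 : ((n + 1 : ℕ) : ℝ) ≤ 2 * n := by exact_mod_cast (by lia : n + 1 ≤ 2 * n)
    calc c / 2 * growth β ((n + 1 : ℕ) / d) ≤ c / 2 * growth β (2 * (n / d)) := by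
          rw [← mul_div_assoc]
          gcongr
          exact monotone_growth hβ (by gcongr)
      _ ≤ c / 2 * (2 * growth β (n / d)) := by gcongr; exact growth_mul_le hβ one_le_two _
      _ ≤ eig a n d := by linarith

theorem IsOptimistic.norm_sub_sq_mul_growth_le (ho : IsOptimistic β θ a T) (hd : 1 ≤ d)
    (hβ : 0 ≤ β) {c : ℝ} (hc0 : 0 ≤ c) (hc : c ≤ 1) (hn : n < T)
    (h : c * growth β (n / d) ≤ eig a n d) :
    ‖a (n + 1) - θ‖ ^ 2 * (c * growth β ((n + 1 : ℕ) / d)) ≤ 32 * β ^ 2 := by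
  have hhalf := half_growth_succ_le_eig_last hd hβ hc0 hc h
  calc ‖a (n + 1) - θ‖ ^ 2 * (c * growth β ((n + 1 : ℕ) / d))
      ≤ ‖a (n + 1) - θ‖ ^ 2 * (2 * eig a n d) :=
        mul_le_mul_of_nonneg_left (by linarith) (sq_nonneg _)
    _ ≤ 32 * β ^ 2 := by linarith [ho.norm_sub_sq_mul_le hd hn]

theorem IsOptimistic.sum_norm_sub_le (ho : IsOptimistic β θ a T) (hd : 1 ≤ d) (hβ : 0 ≤ β)
    {c : ℝ} (hc0 : 0 ≤ c) (hc : c ≤ 1) (hn : n ≤ T)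
    (hlow : ∀ k < n, c * growth β (k / d) ≤ eig a k d)
    (hup : eig a n d ≤ 3 * c * growth β (n / d)) :
    ∑ s ∈ Finset.Icc 1 n, ‖a s - θ‖ ≤ 20 * n * β / √(eig a n d) := by
  have hL : 0 < √(eig a n d) :=
    Real.sqrt_pos.2 (one_pos.trans_le (one_le_eig_last hd a n))
  have hterm : ∀ s ∈ Finset.Icc 1 n, ‖a s - θ‖ * √s ≤ 10 * β * √n / √(eig a n d) := by
    intro s hs
    obtain ⟨k, rfl⟩ : ∃ k, s = k + 1 := ⟨s - 1, by grind⟩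
    have hkn : k + 1 ≤ n := (Finset.mem_Icc.1 hs).2
    have hk0 : (0 : ℝ) < (k + 1 : ℕ) := by positivity
    have hscale : growth β (n / d) ≤ n / (k + 1 : ℕ) * growth β ((k + 1 : ℕ) / d) := by
      have h := growth_mul_le hβ ((one_le_div hk0).2 (Nat.cast_le.2 hkn)) ((k + 1 : ℕ) / d)
      rwa [div_mul_div_cancel₀ hk0.ne'] at h
    have hstep := ho.norm_sub_sq_mul_growth_le hd hβ hc0 hc (by lia) (hlow k (by lia))
    rw [le_div_iff₀ hL]
    refine abs_le_of_sq_le_sq' ?_ (by positivity) |>.2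
    rw [mul_pow, mul_pow, mul_pow, Real.sq_sqrt hk0.le, Real.sq_sqrt n.cast_nonneg,
      Real.sq_sqrt (Real.sqrt_pos.1 hL).le]
    calc ‖a (k + 1) - θ‖ ^ 2 * (k + 1 : ℕ) * eig a n d
        ≤ ‖a (k + 1) - θ‖ ^ 2 * (k + 1 : ℕ) *
            (3 * c * (n / (k + 1 : ℕ) * growth β ((k + 1 : ℕ) / d))) := by
          gcongr
          exact hup.trans (by gcongr)
      _ = 3 * n * (‖a (k + 1) - θ‖ ^ 2 * (c * growth β ((k + 1 : ℕ) / d))) := by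
          field_simp
      _ ≤ 3 * n * (32 * β ^ 2) := by gcongr
      _ ≤ (10 * β) ^ 2 * n := by nlinarith [(by positivity : 0 ≤ β ^ 2 * n)]
  refine (sum_Icc_le_of_mul_sqrt_le (by positivity) hterm).trans_eq ?_
  rw [mul_div_assoc', div_mul_eq_mul_div]
  congr 1
  linear_combination 20 * β * Real.mul_self_sqrt (n.cast_nonneg : (0 : ℝ) ≤ n)

end OptimisticRun

section SmallestEigenvalue

variable {d : ℕ} {β : ℝ} {θ : Vec d} {a : ℕ → Vec d} {T n : ℕ}

theorem norm_mean_sub_le {E : Type*} [NormedAddCommGroup E] [NormedSpace ℝ E] (a : ℕ → E) (θ : E)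
    (hn : 1 ≤ n) :
    ‖(n : ℝ)⁻¹ • ∑ s ∈ Finset.Icc 1 n, a s - θ‖ ≤
      (n : ℝ)⁻¹ * ∑ s ∈ Finset.Icc 1 n, ‖a s - θ‖ := by
  have hsum : (n : ℝ)⁻¹ • ∑ s ∈ Finset.Icc 1 n, a s - θ =
      (n : ℝ)⁻¹ • ∑ s ∈ Finset.Icc 1 n, (a s - θ) := by
    rw [Finset.sum_sub_distrib, smul_sub, Finset.sum_const, Nat.card_Icc, Nat.add_sub_cancel,
      ← Nat.cast_smul_eq_nsmul ℝ, inv_smul_smul₀ (by positivity)]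
  rw [hsum, norm_smul, norm_inv, Real.norm_natCast]
  gcongr
  exact norm_sum_le _ _

theorem IsOptimistic.norm_sub_mean_sq_le (ho : IsOptimistic β θ a T) (hd : 1 ≤ d) (hn : 1 ≤ n)
    (hnT : n < T) (havg : ∑ s ∈ Finset.Icc 1 n, ‖a s - θ‖ ≤ 20 * n * β / √(eig a n d)) :
    ‖a (n + 1) - (n : ℝ)⁻¹ • ∑ s ∈ Finset.Icc 1 n, a s‖ ^ 2 ≤ 576 * β ^ 2 / eig a n d := by
  have hn0 : (0 : ℝ) < n := by exact_mod_cast hn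
  set m := (n : ℝ)⁻¹ • ∑ s ∈ Finset.Icc 1 n, a s
  have hmean : ‖m - θ‖ ≤ 20 * β / √(eig a n d) := by
    refine (norm_mean_sub_le a θ hn).trans ((inv_mul_le_iff₀ hn0).2 (havg.trans_eq ?_))
    ring
  calc ‖a (n + 1) - m‖ ^ 2 ≤ (4 * β / √(eig a n d) + 20 * β / √(eig a n d)) ^ 2 := by
        gcongr
        rw [← sub_sub_sub_cancel_right _ m θ]
        exact (norm_sub_le _ _).trans (add_le_add (ho.dist_le n hnT) hmean)
    _ = 576 * β ^ 2 / √(eig a n d) ^ 2 := by ring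
    _ = 576 * β ^ 2 / eig a n d := by
      rw [Real.sq_sqrt (zero_le_one.trans (one_le_eig_last hd a n))]

theorem IsOptimistic.inv_eig_last_le_or (ho : IsOptimistic β θ a T) (hd : 1 ≤ d) (hβ : 0 < β)
    (hn : n < T) :
    (2 * eig a n d)⁻¹ ≤ inner ℝ (a (n + 1)) (covInv 1 a n (a (n + 1))) ∨
      β ^ 2 / (4 * eig a n d ^ 2) ≤ inner ℝ (a (n + 1)) (covInv 1 a n (a (n + 1))) := by
  obtain ⟨w, hw, hmax⟩ := ho.maximizes n hn
  have hL : eig a n d ≠ 0 := (one_pos.trans_le (one_le_eig_last hd a n)).ne'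
  have hV : (covInv 1 a n).IsPositive := covInv_isPositive one_pos
  have hv : covInv 1 a n (eigBasis a n ⟨d - 1, by lia⟩) =
      (eig a n d)⁻¹ • eigBasis a n ⟨d - 1, by lia⟩ :=
    covInv_eigenvector one_pos hL (by rw [covOp_eigBasis, Nat.sub_add_cancel hd])
  rw [← weightedNorm_sq hV]
  refine (weightedNorm_sq_ge_of_isMaxOn hV hβ (OrthonormalBasis.norm_eq_one _ _) hv hw
    (ho.norm_le n hn) hmax).imp (le_trans (le_of_eq ?_)) (le_trans (le_of_eq ?_))
  · ring
  · ring

/-- The bound on the weighted norm of the action decides the case: if it is `1 / (2 λ_{n,d})`, the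
large eigenvalues contribute little because `‖a (n + 1)‖ ≤ 1`, and otherwise because `a (n + 1)` is
close to the mean of the past actions. -/
theorem IsOptimistic.lowMass_ge (ho : IsOptimistic β θ a T) (hd : 1 ≤ d) (hβ : 0 < β) (hn : 1 ≤ n)
    (hnT : n < T) (havg : ∑ s ∈ Finset.Icc 1 n, ‖a s - θ‖ ≤ 20 * n * β / √(eig a n d))
    (hsmall : 50 * eig a n d ^ 2 ≤ β ^ 2 * n) :
    min (1 / 4) (β ^ 2 / (8 * eig a n d)) ≤ lowMass (eigBasis a n) (fun i => eig a n (i + 1))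
      (30000 * eig a n d) (a (n + 1)) := by
  have hL : 0 < eig a n d := one_pos.trans_le (one_le_eig_last hd a n)
  have hmass (m : Vec d) := inner_covInv_le_lowMass_add hL (fun i => eig_last_le i)
    (covOp_eigBasis a n) (ρ := 30000 * eig a n d) (by positivity) (a (n + 1)) m
  have hstep := ho.norm_sub_mean_sq_le hd hn hnT havg
  have hmean := inner_covInv_mean_le one_pos a hn
  set L := eig a n d
  set x := a (n + 1)
  set M := lowMass (eigBasis a n) (fun i => eig a n (i + 1)) (30000 * L) x
  rcases ho.inv_eig_last_le_or hd hβ hnT with h | h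
  · refine (min_le_left _ _).trans ?_
    have hx : ‖x‖ ^ 2 / (30000 * L) ≤ 1 / (30000 * L) := by
      gcongr
      exact pow_le_one₀ (norm_nonneg _) (ho.norm_le n hnT)
    have h0 := hmass 0
    rw [inner_zero_left, mul_zero, add_zero, sub_zero] at h0
    have hle : (2 * L)⁻¹ ≤ M / L + 2 * (1 / (30000 * L)) := by linarith
    field_simp at hle
    linarith
  · refine (min_le_right _ _).trans ?_
    set m := (n : ℝ)⁻¹ • ∑ s ∈ Finset.Icc 1 n, a s
    have hn0 : (0 : ℝ) < n := by exact_mod_cast hn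
    have hdist : ‖x - m‖ ^ 2 / (30000 * L) ≤ 576 * β ^ 2 / L / (30000 * L) := by gcongr
    have hinv : 1 / (n : ℝ) ≤ β ^ 2 / (50 * L ^ 2) := by
      rw [div_le_div_iff₀ hn0 (by positivity)]
      linarith
    have hle : β ^ 2 / (4 * L ^ 2) ≤
        M / L + 2 * (β ^ 2 / (50 * L ^ 2)) + 2 * (576 * β ^ 2 / L / (30000 * L)) := by
      linarith [hmass m]
    rw [div_le_iff₀ (by positivity)]
    field_simp at hle
    nlinarith [sq_nonneg β]

end SmallestEigenvalue

section SmallestEigenvalueGrowth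

variable {d : ℕ} {β : ℝ} {θ : Vec d} {a : ℕ → Vec d} {T t : ℕ}

theorem IsOptimistic.lowMass_ge_of_eig_last_le (ho : IsOptimistic β θ a T) (hd : 1 ≤ d)
    (hβ : 0 < β) {L : ℝ} (hL : L = growth β (t / d) / 3000000) (htT : t ≤ T)
    (hlow : ∀ k < t, 1 / 3000000 * growth β (k / d) ≤ eig a k d) (ht : eig a t d ≤ L) {n : ℕ}
    (hn : 1 ≤ n) (hnt : n < t) (htn : t ≤ 3 * n) :
    min (1 / 4) (β ^ 2 / (8 * L)) ≤
      lowMass (eigBasis a n) (fun i => eig a n (i + 1)) (30000 * L) (a (n + 1)) := by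
  have hLn : eig a n d ≤ L := (monotone_eig_last hd a hnt.le).trans ht
  have hLn0 : 0 < eig a n d := one_pos.trans_le (one_le_eig_last hd a n)
  have htn' : (t : ℝ) ≤ 3 * n := by exact_mod_cast htn
  have htd : (t : ℝ) / d ≤ 3 * (n / d) := by rw [← mul_div_assoc]; gcongr
  have hup : eig a n d ≤ 3 * (1 / 3000000) * growth β (n / d) := by
    linarith [(monotone_growth hβ.le htd).trans (growth_mul_le hβ.le (by norm_num) _)]
  have hsmall : 50 * eig a n d ^ 2 ≤ β ^ 2 * n := by
    have hnd : (n : ℝ) / d ≤ n := div_le_self n.cast_nonneg (by exact_mod_cast hd)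
    calc 50 * eig a n d ^ 2 ≤ 50 * (3 * (1 / 3000000) * growth β (n / d)) ^ 2 := by gcongr
      _ ≤ growth β (n / d) ^ 2 := by nlinarith [sq_nonneg (growth β (n / d))]
      _ ≤ β ^ 2 * (n / d) := growth_sq_le hβ.le (by positivity)
      _ ≤ β ^ 2 * n := by gcongr
  have havg := ho.sum_norm_sub_le hd hβ.le (by norm_num) (by norm_num) (hnt.le.trans htT)
    (fun k hk => hlow k (hk.trans hnt)) hup
  calc min (1 / 4) (β ^ 2 / (8 * L)) ≤ min (1 / 4) (β ^ 2 / (8 * eig a n d)) := by gcongr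
    _ ≤ _ := ho.lowMass_ge hd hβ hn (hnt.trans_le htT) havg hsmall
    _ ≤ _ := monotone_lowMass _ _ _ (by gcongr)

theorem IsOptimistic.mul_le_of_le_lowMass (ho : IsOptimistic β θ a T) (htT : t ≤ T) {m ρ : ℝ}
    (hm : 0 ≤ m) (hρ : 1 ≤ ρ)
    (h : ∀ n ∈ Finset.Ico (t / 2) t,
      m ≤ lowMass (eigBasis a n) (fun i => eig a n (i + 1)) ρ (a (n + 1))) :
    t * m ≤ 16 * ρ * d := by
  have hcard : (t : ℝ) ≤ 2 * (t - t / 2 : ℕ) := by exact_mod_cast (by lia : t ≤ 2 * (t - t / 2))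
  have hsum : ((t - t / 2 : ℕ) : ℝ) * m ≤ 8 * ρ * Module.finrank ℝ (Vec d) := by
    calc ((t - t / 2 : ℕ) : ℝ) * m
      _ ≤ ∑ n ∈ Finset.Ico (t / 2) t,
            lowMass (eigBasis a n) (fun i => eig a n (i + 1)) ρ (a (n + 1)) := by
          simpa using Finset.card_nsmul_le_sum _ _ _ h
      _ ≤ ∑ n ∈ Finset.range t,
            lowMass (eigBasis a n) (fun i => eig a n (i + 1)) ρ (a (n + 1)) :=
          Finset.sum_le_sum_of_subset_of_nonneg
            (fun n hn => Finset.mem_range.2 (Finset.mem_Ico.1 hn).2)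
            fun n _ _ => lowMass_nonneg _ _ _ _
      _ ≤ 8 * ρ * Module.finrank ℝ (Vec d) :=
          sum_lowMass_le (fun n => covOp_eigBasis a n) hρ fun n hn => ho.norm_le n (hn.trans_le htT)
  rw [finrank_euclideanSpace_fin] at hsum
  linarith [mul_le_mul_of_nonneg_right hcard hm]

theorem lt_mul_min_of_growth {y L : ℝ} (hβ : 0 < β) (hL : L = growth β y / 3000000)
    (hL0 : 0 < L) : 480000 * L < y * min (1 / 4) (β ^ 2 / (8 * L)) := by
  have hy : 3000000 * L ≤ y := by linarith [growth_le_self β y]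
  have hy0 : 0 < y := by linarith
  have hsq : (3000000 * L) ^ 2 ≤ β ^ 2 * y := by
    rw [hL, mul_div_cancel₀ _ (by norm_num)]
    exact growth_sq_le hβ.le hy0.le
  rw [mul_min_of_nonneg _ _ hy0.le, lt_min_iff]
  refine ⟨by linarith, ?_⟩
  rw [← mul_div_assoc, lt_div_iff₀ (by positivity)]
  nlinarith [pow_pos hL0 2]

/-- While `λ_{t,d}` is below its order of growth, every one of the last `t / 2` actions explores the
directions of small eigenvalue, so the trace of `(ρ - 1 + Λ_t)⁻¹` would decrease by more than its
initial value `d / ρ`. -/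
theorem IsOptimistic.growth_le_eig_last (ho : IsOptimistic β θ a T) (hd : 1 ≤ d) (hβ : 0 < β) :
    ∀ t ≤ T, 1 / 3000000 * growth β (t / d) ≤ eig a t d := by
  intro t
  induction t using Nat.strong_induction_on with
  | _ t ih =>
  intro htT
  by_contra! hcon
  obtain ⟨L, hL⟩ : ∃ L, L = growth β (t / d) / 3000000 := ⟨_, rfl⟩
  have hlt : eig a t d < L := by linarith
  have hL1 : 1 < L := (one_le_eig_last hd a t).trans_lt hlt
  have hd0 : (0 : ℝ) < d := by exact_mod_cast hd
  have ht2 : 2 ≤ t := by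
    have hle : 2 ≤ (t : ℝ) / d := by linarith [growth_le_self β (t / d)]
    rw [le_div_iff₀ hd0] at hle
    have hd1 : (1 : ℝ) ≤ d := by exact_mod_cast hd
    exact_mod_cast (by linarith : (2 : ℝ) ≤ t)
  have hmul := ho.mul_le_of_le_lowMass htT (ρ := 30000 * L) (m := min (1 / 4) (β ^ 2 / (8 * L)))
    (by positivity) (by linarith) fun n hn => by
      obtain ⟨hn1, hn2⟩ := Finset.mem_Ico.1 hn
      exact ho.lowMass_ge_of_eig_last_le hd hβ hL htT (fun k hk => ih k hk (hk.le.trans htT)) hlt.le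
        (by lia) hn2 (by lia)
  have hgt := lt_mul_min_of_growth hβ hL (one_pos.trans hL1)
  rw [div_mul_eq_mul_div, lt_div_iff₀ hd0] at hgt
  linarith

end SmallestEigenvalueGrowth

section LeadingEigenvector

theorem norm_sq_sub_inner_sq_le {E : Type*} [NormedAddCommGroup E] [InnerProductSpace ℝ E]
    {θ : E} (hθ : ‖θ‖ = 1) (x : E) : ‖x‖ ^ 2 - inner ℝ x θ ^ 2 ≤ ‖x - θ‖ ^ 2 := by
  rw [norm_sub_sq_real, hθ]
  linarith [sq_nonneg (1 - inner ℝ x θ)]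

/-- Both unit vectors carry almost all of the mass `∑ ‖a i‖²`: the component of `a i` orthogonal to
`θ` has norm at most `‖a i - θ‖`, and `v` captures even more than `θ`. -/
theorem card_mul_norm_sub_sq_le {E ι : Type*} [NormedAddCommGroup E] [InnerProductSpace ℝ E]
    (s : Finset ι) (a : ι → E) {θ v : E} (hθ : ‖θ‖ = 1) (hv : ‖v‖ = 1) (hvθ : 0 ≤ inner ℝ v θ)
    (h : ∑ i ∈ s, inner ℝ (a i) θ ^ 2 ≤ ∑ i ∈ s, inner ℝ (a i) v ^ 2) :
    s.card * ‖v - θ‖ ^ 2 ≤ 8 * ∑ i ∈ s, ‖a i - θ‖ ^ 2 := by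
  have hx1 : inner ℝ v θ ≤ 1 := by simpa [hv, hθ] using real_inner_le_norm v θ
  have hvθ_sq : ‖v - θ‖ ^ 2 = 2 - 2 * inner ℝ v θ := by rw [norm_sub_sq_real, hv, hθ]; ring
  have hterm (i : ι) : ‖v - θ‖ ^ 2 ≤
      4 * (‖a i‖ ^ 2 - inner ℝ (a i) v ^ 2) + 4 * ‖a i - θ‖ ^ 2 := by
    have hcs : inner ℝ ((2 : ℝ) • a i - θ) v ^ 2 ≤ ‖(2 : ℝ) • a i - θ‖ ^ 2 := by
      refine sq_le_sq' ?_ ?_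
      · simpa [hv] using neg_le_of_abs_le (abs_real_inner_le_norm ((2 : ℝ) • a i - θ) v)
      · simpa [hv] using real_inner_le_norm ((2 : ℝ) • a i - θ) v
    rw [norm_sub_sq_real, inner_sub_left, real_inner_smul_left, real_inner_smul_left, norm_smul,
      Real.norm_ofNat, hθ, real_inner_comm v θ] at hcs
    rw [hvθ_sq, norm_sub_sq_real, hθ]
    nlinarith [sq_nonneg (inner ℝ (a i) v - inner ℝ v θ)]
  have hsum := Finset.card_nsmul_le_sum s _ _ fun i _ => hterm i
  have hθ_sum := Finset.sum_le_sum fun i (_ : i ∈ s) => norm_sq_sub_inner_sq_le hθ (a i)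
  rw [Finset.sum_add_distrib, ← Finset.mul_sum, ← Finset.mul_sum, nsmul_eq_mul] at hsum
  rw [Finset.sum_sub_distrib] at hsum hθ_sum
  linarith

variable {d : ℕ} {θ v : Vec d} {a : ℕ → Vec d} {t : ℕ}

theorem IsLeadingEigenvector.covOp_apply (hv : IsLeadingEigenvector θ a t v) :
    covOp 1 a t v = eig a t 1 • v := by
  rw [← toEuclideanLin_cov]
  ext i
  simpa using congrFun hv.2.1 i

theorem IsLeadingEigenvector.mul_norm_sub_sq_le (hθ : ‖θ‖ = 1)
    (hv : IsLeadingEigenvector θ a t v) :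
    t * ‖v - θ‖ ^ 2 ≤ 8 * ∑ s ∈ Finset.Icc 1 t, ‖a s - θ‖ ^ 2 := by
  have hle := inner_covOp_le_eig_one_mul_norm_sq a t θ
  have hv_eq : inner ℝ v (covOp 1 a t v) = eig a t 1 := by
    rw [hv.covOp_apply, real_inner_smul_right, real_inner_self_eq_norm_sq, hv.1, one_pow, mul_one]
  rw [hθ, one_pow, mul_one, ← hv_eq, inner_covOp_self, inner_covOp_self, hθ, hv.1] at hle
  simpa using card_mul_norm_sub_sq_le (Finset.Icc 1 t) a hθ hv.1 hv.2.2 (by linarith)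

theorem sum_eig_Icc_two_le (hd : 1 ≤ d) (hθ : ‖θ‖ = 1) (a : ℕ → Vec d) (t : ℕ) :
    ∑ i ∈ Finset.Icc 2 d, eig a t i ≤ (d - 1) + ∑ s ∈ Finset.Icc 1 t, ‖a s - θ‖ ^ 2 := by
  have htrace := sum_eig a t
  rw [← Finset.add_sum_Ioc_eq_sum_Icc hd,
    show Finset.Ioc 1 d = Finset.Icc 2 d from rfl] at htrace
  have hlead := inner_covOp_le_eig_one_mul_norm_sq a t θ
  have hsum := Finset.sum_le_sum fun s (_ : s ∈ Finset.Icc 1 t) => norm_sq_sub_inner_sq_le hθ (a s)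
  rw [inner_covOp_self, hθ] at hlead
  rw [Finset.sum_sub_distrib] at hsum
  linarith

end LeadingEigenvector

section Spectrum

variable {d : ℕ} {β κ : ℝ} {θ : Vec d} {a : ℕ → Vec d} {T t : ℕ}

theorem IsOptimistic.norm_sub_sq_mul_sqrt_le (ho : IsOptimistic β θ a T) (hd : 1 ≤ d)
    (hβ : 0 < β) (hθ : ‖θ‖ = 1) {s : ℕ} (hs : s ∈ Finset.Icc 1 T) :
    ‖a s - θ‖ ^ 2 * √(s / d) ≤ 192000000 * β := by
  obtain ⟨k, rfl⟩ : ∃ k, s = k + 1 := ⟨s - 1, by grind⟩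
  have hkT : k < T := (Finset.mem_Icc.1 hs).2
  have hgrowth := ho.norm_sub_sq_mul_growth_le hd hβ.le (by norm_num) (by norm_num) hkT
    (ho.growth_le_eig_last hd hβ k hkT.le)
  set y : ℝ := (k + 1 : ℕ) / d
  have hy : 0 < √y := Real.sqrt_pos.2 (by positivity)
  have hyy : √y * √y = y := Real.mul_self_sqrt (by positivity)
  rcases le_total y (β * √y) with h | h
  · have hyβ : √y ≤ β := le_of_mul_le_mul_right (hyy.trans_le h) hy
    have hdist : ‖a (k + 1) - θ‖ ≤ 2 := by
      linarith [norm_sub_le (a (k + 1)) θ, ho.norm_le k hkT]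
    calc ‖a (k + 1) - θ‖ ^ 2 * √y ≤ 2 ^ 2 * β := by gcongr
      _ ≤ 192000000 * β := by linarith
  · rw [growth, min_eq_right h] at hgrowth
    refine le_of_mul_le_mul_right ?_ hβ
    linarith [sq_nonneg β]

theorem IsOptimistic.sum_norm_sub_sq_le (ho : IsOptimistic β θ a T) (hd : 1 ≤ d) (hβ : 0 < β)
    (hθ : ‖θ‖ = 1) (htT : t ≤ T) :
    ∑ s ∈ Finset.Icc 1 t, ‖a s - θ‖ ^ 2 ≤ 384000000 * (β * √(t / d)) * d := by
  have hd0 : (0 : ℝ) < √d := Real.sqrt_pos.2 (by exact_mod_cast hd)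
  have hterm : ∀ s ∈ Finset.Icc 1 t, ‖a s - θ‖ ^ 2 * √s ≤ 192000000 * β * √d := fun s hs => by
    have h := ho.norm_sub_sq_mul_sqrt_le hd hβ hθ (Finset.Icc_subset_Icc_right htT hs)
    rwa [Real.sqrt_div s.cast_nonneg, mul_div_assoc', div_le_iff₀ hd0] at h
  refine (sum_Icc_le_of_mul_sqrt_le (by positivity) hterm).trans_eq ?_
  rw [Real.sqrt_div t.cast_nonneg]
  field_simp
  rw [Real.sq_sqrt d.cast_nonneg]
  ring

theorem sqrt_mul_le_sqrt_div (hd : 1 ≤ d) (hβ : 0 ≤ β) (ht : κ * (β ^ 2 * d) ≤ t) :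
    √κ * β ≤ √(t / d) := by
  rw [← Real.sqrt_sq hβ, ← Real.sqrt_mul' _ (sq_nonneg β)]
  refine Real.sqrt_le_sqrt ((le_div_iff₀ (by exact_mod_cast hd)).2 ?_)
  linarith

theorem IsOptimistic.mul_sqrt_le_eig_last (ho : IsOptimistic β θ a T) (hd : 1 ≤ d) (hβ : 0 < β)
    (ht : κ * (β ^ 2 * d) ≤ t) (htT : t ≤ T) :
    1 / 3000000 * min 1 √κ * (β * √(t / d)) ≤ eig a t d := by
  have hκ := sqrt_mul_le_sqrt_div hd hβ.le ht
  refine le_trans ?_ (ho.growth_le_eig_last hd hβ t htT)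
  rw [mul_assoc]
  gcongr
  refine le_min ?_ (mul_le_of_le_one_left (by positivity) (min_le_left _ _))
  calc min 1 √κ * (β * √(t / d)) ≤ √κ * (β * √(t / d)) := by gcongr; exact min_le_right _ _
    _ = √κ * β * √(t / d) := by ring
    _ ≤ √(t / d) * √(t / d) := by gcongr
    _ = t / d := Real.mul_self_sqrt (by positivity)

theorem IsOptimistic.meanEig_le (ho : IsOptimistic β θ a T) (hd : 2 ≤ d) (hκ : 0 < κ)
    (hβ : 1 ≤ β) (hθ : ‖θ‖ = 1) (ht : κ * (β ^ 2 * d) ≤ t) (htT : t ≤ T) :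
    meanEig a t ≤ (1 / √κ + 768000000) * (β * √(t / d)) := by
  have hd2 : (2 : ℝ) ≤ d := by exact_mod_cast hd
  have hκ0 : 0 < √κ := Real.sqrt_pos.2 hκ
  have hβ0 : 0 < β := one_pos.trans_le hβ
  have hone : 1 ≤ 1 / √κ * (β * √(t / d)) := by
    rw [one_div, inv_mul_eq_div, one_le_div hκ0]
    calc √κ ≤ √κ * β := le_mul_of_one_le_right hκ0.le hβ
      _ ≤ √(t / d) := sqrt_mul_le_sqrt_div (by lia) hβ0.le ht
      _ ≤ β * √(t / d) := le_mul_of_one_le_left (Real.sqrt_nonneg _) hβ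
  rw [meanEig, div_le_iff₀ (by linarith)]
  calc ∑ i ∈ Finset.Icc 2 d, eig a t i
      ≤ (d - 1) + 384000000 * (β * √(t / d)) * d :=
        (sum_eig_Icc_two_le (by lia) hθ a t).trans <| by
          gcongr
          exact ho.sum_norm_sub_sq_le (by lia) hβ0 hθ htT
    _ ≤ 1 / √κ * (β * √(t / d)) * (d - 1) + 384000000 * (β * √(t / d)) * (2 * (d - 1)) := by
        gcongr
        · exact le_mul_of_one_le_left (by linarith) hone
        · linarith
    _ = (1 / √κ + 768000000) * (β * √(t / d)) * (d - 1) := by ring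

theorem IsOptimistic.norm_sub_le_of_isLeadingEigenvector (ho : IsOptimistic β θ a T) (hd : 1 ≤ d)
    (hβ : 0 < β) (hθ : ‖θ‖ = 1) (ht : 1 ≤ t) (htT : t ≤ T) {C : ℝ} (hC : 0 ≤ C)
    (hL : eig a t d ≤ C * (β * √(t / d))) {v : Vec d} (hv : IsLeadingEigenvector θ a t v) :
    ‖v - θ‖ ≤ √(3072000000 * C) * (β / √(eig a t d)) := by
  have hL0 : 0 < eig a t d := one_pos.trans_le (one_le_eig_last hd a t)
  have ht0 : (0 : ℝ) < t := by exact_mod_cast ht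
  have hd0 : (0 : ℝ) < d := by exact_mod_cast hd
  have hdist := (hv.mul_norm_sub_sq_le hθ).trans
    (mul_le_mul_of_nonneg_left (ho.sum_norm_sub_sq_le hd hβ hθ htT) (by norm_num))
  rw [← mul_div_assoc, le_div_iff₀ (Real.sqrt_pos.2 hL0)]
  refine abs_le_of_sq_le_sq' ?_ (by positivity) |>.2
  rw [mul_pow, mul_pow, Real.sq_sqrt hL0.le, Real.sq_sqrt (by positivity)]
  refine le_of_mul_le_mul_left ?_ ht0
  calc t * (‖v - θ‖ ^ 2 * eig a t d) = t * ‖v - θ‖ ^ 2 * eig a t d := by ring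
    _ ≤ 8 * (384000000 * (β * √(t / d)) * d) * (C * (β * √(t / d))) := by gcongr
    _ = 3072000000 * C * β ^ 2 * (√(t / d) * √(t / d) * d) := by ring
    _ = t * (3072000000 * C * β ^ 2) := by
      rw [Real.mul_self_sqrt (by positivity), div_mul_cancel₀ _ hd0.ne', mul_comm]

theorem IsOptimistic.exists_comparable (hκ : 0 < κ) :
    ∃ c > (0 : ℝ), ∃ C > (0 : ℝ), ∀ {d : ℕ} (_ : 2 ≤ d) {T : ℕ} {β : ℝ} (_ : 1 ≤ β)
      {θ : Vec d} (_ : ‖θ‖ = 1) {a : ℕ → Vec d} (_ : IsOptimistic β θ a T) {t : ℕ},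
      κ * (β ^ 2 * d) ≤ t → t ≤ T →
        Comparable c C (eig a t d) (meanEig a t) ∧
        Comparable c C (meanEig a t) (β * √((t : ℝ) / d)) ∧
        ∀ v : Vec d, IsLeadingEigenvector θ a t v → ‖v - θ‖ ≤ C * (β / √(eig a t d)) := by
  obtain ⟨c, hc⟩ : ∃ c, c = 1 / 3000000 * min 1 √κ := ⟨_, rfl⟩
  obtain ⟨C, hC⟩ : ∃ C, C = 1 / √κ + 768000000 := ⟨_, rfl⟩
  have hc0 : 0 < c := hc ▸ mul_pos (by norm_num) (lt_min one_pos (Real.sqrt_pos.2 hκ))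
  have hC1 : 1 ≤ C := by linarith [one_div_nonneg.2 (Real.sqrt_nonneg κ)]
  have hC0 : 0 < C := one_pos.trans_le hC1
  have hsqrt := Real.sqrt_nonneg (3072000000 * C)
  refine ⟨c / C, by positivity, C + √(3072000000 * C), by positivity, ?_⟩
  intro d hd T β hβ θ hθ a ho t ht htT
  have hβ0 : 0 < β := one_pos.trans_le hβ
  have hlow := hc ▸ ho.mul_sqrt_le_eig_last (by lia) hβ0 ht htT
  have hup := hC ▸ ho.meanEig_le hd hκ hβ hθ ht htT
  have hle := eig_last_le_meanEig hd a t
  have hone := one_le_eig_last (by lia) a t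
  have : 0 < d := by lia
  have ht1 : 1 ≤ t := by exact_mod_cast (by positivity : 0 < κ * (β ^ 2 * d)).trans_le ht
  have hg : 0 ≤ β * √((t : ℝ) / d) := by positivity
  refine ⟨⟨?_, ?_⟩, ⟨?_, ?_⟩, fun v hv => ?_⟩
  · rw [div_mul_eq_mul_div, div_le_iff₀ hC0]
    nlinarith
  · nlinarith
  · exact (mul_le_mul_of_nonneg_right (div_le_self hc0.le hC1) hg).trans (hlow.trans hle)
  · nlinarith
  · refine (ho.norm_sub_le_of_isLeadingEigenvector (by lia) hβ0 hθ ht1 htT hC0.le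
      (hle.trans hup) hv).trans ?_
    gcongr
    linarith

end Spectrum

section ConfidenceEllipsoid

variable {d : ℕ} {e θ x : Vec d}

theorem norm_sphereProj_of_ne_zero (hx : x ≠ 0) : ‖sphereProj e x‖ = 1 := by
  rw [sphereProj, if_neg hx, norm_smul, norm_inv, norm_norm,
    inv_mul_cancel₀ (norm_ne_zero_iff.2 hx)]

theorem norm_sphereProj_le (he : ‖e‖ ≤ 1) : ‖sphereProj e x‖ ≤ 1 := by
  rcases eq_or_ne x 0 with rfl | hx
  · rwa [sphereProj, if_pos rfl]
  · exact (norm_sphereProj_of_ne_zero hx).le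

theorem norm_sphereProj_sub_le (hx : x ≠ 0) (hθ : ‖θ‖ = 1) :
    ‖sphereProj e x - θ‖ ≤ 2 * ‖x - θ‖ := by
  have hx0 : ‖x‖ ≠ 0 := norm_ne_zero_iff.2 hx
  have hproj : sphereProj e x - x = ((1 - ‖x‖) * ‖x‖⁻¹) • x := by
    rw [sphereProj, if_neg hx, sub_mul, mul_inv_cancel₀ hx0, sub_smul, one_mul, one_smul]
  have hradial : ‖sphereProj e x - x‖ ≤ ‖x - θ‖ := by
    rw [hproj, norm_smul, norm_mul, norm_inv, norm_norm, mul_assoc, inv_mul_cancel₀ hx0, mul_one,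
      ← hθ, norm_sub_rev x θ]
    exact abs_norm_sub_norm_le θ x
  linarith [norm_sub_le_norm_sub_add_norm_sub (sphereProj e x) x θ]

theorem IsOptimistic.of_norm_ridge_sub_le (hd : 1 ≤ d) {T : ℕ} {β : ℝ} (hβ : 0 ≤ β)
    (hθ : ‖θ‖ = 1) (he : ‖e‖ ≤ 1) {a : ℕ → Vec d} {r : ℕ → ℝ}
    (ha : ∀ t ∈ Finset.Icc 1 T, ‖a t‖ ≤ 1)
    (hmax : ∀ t ∈ Finset.Icc 1 T, ∀ b : Vec d, ‖b‖ ≤ 1 → ucb β e a r t b ≤ ucb β e a r t (a t))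
    (hconf : ∀ t < T, ‖ridge a r t - θ‖ ≤ β / √(eig a t d)) : IsOptimistic β θ a T := by
  have hmem (n : ℕ) (hn : n < T) : n + 1 ∈ Finset.Icc 1 T := Finset.mem_Icc.2 ⟨by lia, hn⟩
  have hnorm (n : ℕ) (hn : n < T) := ha (n + 1) (hmem n hn)
  have hscore (n : ℕ) (hn : n < T) :
      IsMaxOn (score β (sphereProj e (ridge a r n)) (covInv 1 a n)) (Metric.closedBall 0 1)
        (a (n + 1)) := fun b hb => by
    have h := hmax (n + 1) (hmem n hn) b (mem_closedBall_zero_iff.1 hb)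
    rwa [ucb_eq_score, Nat.add_sub_cancel] at h
  refine ⟨hnorm, fun n hn => ⟨_, norm_sphereProj_le he, hscore n hn⟩, fun n hn => ?_⟩
  have hc := hconf n hn
  rw [mul_div_assoc]
  by_cases hr : ridge a r n = 0
  · rw [hr, zero_sub, norm_neg, hθ] at hc
    linarith [norm_sub_le (a (n + 1)) θ, hnorm n hn]
  · have hproj := norm_sphereProj_sub_le (e := e) hr hθ
    have hdist := norm_sub_le_of_isMaxOn (covInv_isPositive one_pos) hβ
      (weightedNorm_covInv_le hd a n) (norm_sphereProj_of_ne_zero hr) (hnorm n hn) (hscore n hn)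
    rw [mul_assoc, ← div_eq_mul_inv] at hdist
    linarith [norm_sub_le_norm_sub_add_norm_sub (a (n + 1)) (sphereProj e (ridge a r n)) θ]

theorem sqrt_eig_last_mul_norm_covInv_le (a : ℕ → Vec d) (t : ℕ) (x : Vec d) :
    √(eig a t d) * ‖covInv 1 a t x‖ ≤ weightedNorm (covInv 1 a t) x := by
  have h := eig_last_mul_norm_sq_le a t (covInv 1 a t x)
  rw [covOp_covInv one_pos, real_inner_comm] at h
  rw [← Real.sqrt_sq (norm_nonneg (covInv 1 a t x)), ← Real.sqrt_mul' _ (sq_nonneg _)]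
  exact Real.sqrt_le_sqrt h

/-- The sum `∑ ε_s a_s` of the actions weighted by the noise, the martingale whose self-normalized
size measures the error of the ridge estimator. -/
noncomputable def noiseSum (a : ℕ → Vec d) (ε : ℕ → ℝ) (t : ℕ) : Vec d :=
  ∑ s ∈ Finset.Icc 1 t, ε s • a s

theorem ridge_sub_eq_covInv (θ : Vec d) (a : ℕ → Vec d) (r : ℕ → ℝ) (t : ℕ) :
    ridge a r t - θ = covInv 1 a t (noiseSum a (fun s => r s - inner ℝ (a s) θ) t - θ) := by
  rw [eq_comm, covInv_eq_iff one_pos, map_sub, ridge_eq_covInv, covOp_covInv one_pos, covOp_apply,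
    noiseSum]
  simp only [sub_smul, Finset.sum_sub_distrib, one_smul]
  abel

theorem norm_ridge_sub_le (hd : 1 ≤ d) (hθ : ‖θ‖ = 1) (a : ℕ → Vec d) (r : ℕ → ℝ) (t : ℕ) {R : ℝ}
    (hR : weightedNorm (covInv 1 a t) (noiseSum a (fun s => r s - inner ℝ (a s) θ) t) ≤ R) :
    ‖ridge a r t - θ‖ ≤ (R + 1) / √(eig a t d) := by
  have hone := one_le_eig_last hd a t
  have hθ_le : weightedNorm (covInv 1 a t) (-θ) ≤ 1 := by
    refine (weightedNorm_covInv_le hd a t (-θ)).trans ?_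
    rw [norm_neg, hθ, mul_one]
    exact inv_le_one_of_one_le₀ (Real.one_le_sqrt.2 hone)
  rw [le_div_iff₀ (Real.sqrt_pos.2 (one_pos.trans_le hone)), mul_comm, ridge_sub_eq_covInv,
    sub_eq_add_neg]
  exact (sqrt_eig_last_mul_norm_covInv_le a t _).trans
    ((weightedNorm_add_le (covInv_isPositive one_pos) _ _).trans (add_le_add hR hθ_le))

end ConfidenceEllipsoid

section SelfNormalizedSum

variable {d : ℕ}

theorem det_cov_eq_prod (a : ℕ → Vec d) (t : ℕ) : (cov a t).det = ∏ i : Fin d, eig a t (i + 1) := by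
  rw [(cov_isHermitian a t).det_eq_prod_eigenvalues]
  refine Fintype.prod_equiv ((Fintype.equivOfCardEq (Fintype.card_fin _)).symm.trans
    (finCongr (Fintype.card_fin d))) _ _ fun i => ?_
  rw [eig_coe_add_one]
  rfl

theorem one_le_eig (a : ℕ → Vec d) (t : ℕ) (i : Fin d) : 1 ≤ eig a t (i + 1) :=
  (one_le_eig_last i.pos a t).trans (eig_last_le i)

theorem det_cov_pos (a : ℕ → Vec d) (t : ℕ) : 0 < (cov a t).det :=
  det_cov_eq_prod a t ▸ Finset.prod_pos fun i _ => one_pos.trans_le (one_le_eig a t i)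

theorem log_le_log_add_div_sub_one {x m : ℝ} (hx : 0 < x) (hm : 0 < m) :
    Real.log x ≤ Real.log m + (x / m - 1) := by
  have h := Real.log_le_sub_one_of_pos (div_pos hx hm)
  rw [Real.log_div hx.ne' hm.ne'] at h
  linarith

theorem log_det_cov_le (hd : 1 ≤ d) {a : ℕ → Vec d} {t : ℕ}
    (ha : ∀ s ∈ Finset.Icc 1 t, ‖a s‖ ≤ 1) :
    Real.log (cov a t).det ≤ d * Real.log (1 + t / d) := by
  have hd0 : (0 : ℝ) < d := by exact_mod_cast hd
  have hpos (i : Fin d) : 0 < eig a t (i + 1) := one_pos.trans_le (one_le_eig a t i)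
  set m : ℝ := 1 + t / d with hm
  have hm0 : 0 < m := by positivity
  have hnorm : ∑ s ∈ Finset.Icc 1 t, ‖a s‖ ^ 2 ≤ t := by
    simpa using Finset.sum_le_card_nsmul (Finset.Icc 1 t) (fun s => ‖a s‖ ^ 2) 1
      fun s hs => pow_le_one₀ (norm_nonneg _) (ha s hs)
  have htrace : ∑ i : Fin d, eig a t (i + 1) / m ≤ d := by
    rw [← Finset.sum_div, ← sum_eig_eq_sum_fin, sum_eig, div_le_iff₀ hm0, hm, mul_add, mul_one,
      mul_div_cancel₀ _ hd0.ne']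
    linarith
  calc Real.log (cov a t).det = ∑ i : Fin d, Real.log (eig a t (i + 1)) := by
        rw [det_cov_eq_prod, Real.log_prod fun i _ => (hpos i).ne']
    _ ≤ ∑ i : Fin d, (Real.log m + (eig a t (i + 1) / m - 1)) :=
        Finset.sum_le_sum fun i _ => log_le_log_add_div_sub_one (hpos i) hm0
    _ = d * Real.log m + (∑ i : Fin d, eig a t (i + 1) / m - d) := by
        simp [Finset.sum_add_distrib, Finset.sum_sub_distrib]
    _ ≤ d * Real.log m := by linarith

theorem det_cov_succ (a : ℕ → Vec d) (t : ℕ) :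
    (cov a (t + 1)).det =
      (cov a t).det * (1 + inner ℝ (a (t + 1)) (covInv 1 a t (a (t + 1)))) := by
  have h : cov a (t + 1) = cov a t +
      Matrix.replicateCol Unit (a (t + 1)).ofLp * Matrix.replicateRow Unit (a (t + 1)).ofLp := by
    rw [cov, Finset.sum_Icc_succ_top (by lia), ← add_assoc, ← Matrix.vecMulVec_eq]
    rfl
  rw [h, Matrix.det_add_replicateCol_mul_replicateRow (isUnit_det_cov a t)]
  congr 1
  rw [Matrix.mul_assoc, ← Matrix.replicateCol_mulVec, Matrix.det_unique, Matrix.add_apply,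
    Matrix.one_apply_eq, Matrix.replicateRow_mul_replicateCol_apply, inner_covInv_eq_dotProduct]

theorem noiseSum_succ (a : ℕ → Vec d) (ε : ℕ → ℝ) (t : ℕ) :
    noiseSum a ε (t + 1) = noiseSum a ε t + ε (t + 1) • a (t + 1) :=
  Finset.sum_Icc_succ_top (by lia) _

theorem weightedNorm_noiseSum_sq_succ (a : ℕ → Vec d) (ε : ℕ → ℝ) (t : ℕ) :
    weightedNorm (covInv 1 a (t + 1)) (noiseSum a ε (t + 1)) ^ 2 =
      weightedNorm (covInv 1 a t) (noiseSum a ε t) ^ 2 +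
        (2 * ε (t + 1) * inner ℝ (a (t + 1)) (covInv 1 a t (noiseSum a ε t)) +
          ε (t + 1) ^ 2 * inner ℝ (a (t + 1)) (covInv 1 a t (a (t + 1))) -
          inner ℝ (a (t + 1)) (covInv 1 a t (noiseSum a ε t)) ^ 2) /
          (1 + inner ℝ (a (t + 1)) (covInv 1 a t (a (t + 1)))) := by
  have hV := covInv_isPositive (a := a) (t := t) (ρ := 1) one_pos
  have hw : 0 ≤ inner ℝ (a (t + 1)) (covInv 1 a t (a (t + 1))) := hV.inner_nonneg_right _
  rw [weightedNorm_sq (covInv_isPositive one_pos), inner_covInv_succ_self one_pos, noiseSum_succ,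
    ← weightedNorm_sq hV, weightedNorm_sq_add_smul hV, weightedNorm_sq hV (a (t + 1)), map_add,
    map_smul, inner_add_right, real_inner_smul_right, ← hV.isSymmetric (noiseSum a ε t),
    real_inner_comm (a (t + 1))]
  field_simp
  ring

end SelfNormalizedSum

section MethodOfMixtures

theorem exp_mul_gaussianPDFReal (b : ℝ) {w : ℝ} (hw : 0 ≤ w) (x : ℝ) :
    gaussianPDFReal 0 1 x * Real.exp (b * x - w * x ^ 2 / 2) =
      Real.exp (b ^ 2 / (2 * (1 + w))) / √(1 + w) *
        gaussianPDFReal (b / (1 + w)) (1 + w)⁻¹.toNNReal x := by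
  have hw1 : 0 < 1 + w := by positivity
  have hsq : -x ^ 2 / 2 + (b * x - w * x ^ 2 / 2) =
      b ^ 2 / (2 * (1 + w)) + -(x - b / (1 + w)) ^ 2 / (2 * (1 + w)⁻¹) := by
    field_simp
    ring
  simp only [gaussianPDFReal, Real.coe_toNNReal _ (inv_nonneg.2 hw1.le), NNReal.coe_one, mul_one,
    sub_zero]
  rw [mul_assoc, ← Real.exp_add, hsq, Real.exp_add,
    Real.sqrt_mul' (2 * Real.pi) (inv_nonneg.2 hw1.le), Real.sqrt_inv]
  field_simp

theorem lintegral_exp_sub_sq_gaussianReal (b : ℝ) {w : ℝ} (hw : 0 ≤ w) :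
    ∫⁻ x, ENNReal.ofReal (Real.exp (b * x - w * x ^ 2 / 2)) ∂gaussianReal 0 1 =
      ENNReal.ofReal (Real.exp (b ^ 2 / (2 * (1 + w))) / √(1 + w)) := by
  have hv : (1 + w)⁻¹.toNNReal ≠ 0 := (Real.toNNReal_pos.2 (by positivity)).ne'
  rw [gaussianReal_of_var_ne_zero _ one_ne_zero,
    lintegral_withDensity_eq_lintegral_mul _ (measurable_gaussianPDF 0 1) (by fun_prop)]
  simp only [Pi.mul_apply, gaussianPDF,
    ← ENNReal.ofReal_mul (gaussianPDFReal_nonneg 0 1 _), exp_mul_gaussianPDFReal b hw]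
  rw [lintegral_congr fun x => ENNReal.ofReal_mul (by positivity),
    lintegral_const_mul _ (by fun_prop), lintegral_gaussianPDFReal_eq_one _ hv, mul_one]

theorem lintegral_exp_mul_le {ν : Measure ℝ} {c : NNReal} (hν : HasSubgaussianMGF id c ν) (l : ℝ) :
    ∫⁻ y, ENNReal.ofReal (Real.exp (l * y)) ∂ν ≤ ENNReal.ofReal (Real.exp (c * l ^ 2 / 2)) := by
  have h := hν.integrable_exp_mul l
  simp only [id_eq] at h
  rw [← ofReal_integral_eq_lintegral_ofReal h (ae_of_all _ fun y => Real.exp_nonneg _)]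
  exact ENNReal.ofReal_le_ofReal (hν.mgf_le l)

theorem lintegral_exp_tilt_gaussianReal {c : ℝ} (hc : 0 < c) (u y : ℝ) {w : ℝ} (hw : 0 ≤ w) :
    ENNReal.ofReal √(1 + w) *
        ∫⁻ x, ENNReal.ofReal (Real.exp ((u + √(c * w) * x) / c * y -
          c * ((u + √(c * w) * x) / c) ^ 2 / 2)) ∂gaussianReal 0 1 =
      ENNReal.ofReal (Real.exp ((2 * y * u + y ^ 2 * w - u ^ 2) / (1 + w) / (2 * c))) := by
  have hw1 : 0 < √(1 + w) := Real.sqrt_pos.2 (by positivity)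
  have hsqrt : √(c * w) ^ 2 = c * w := Real.sq_sqrt (by positivity)
  set b : ℝ := √(c * w) * (y - u) / c with hb
  have hbsq : b ^ 2 = w * (y - u) ^ 2 / c := by
    rw [hb, div_pow, mul_pow, hsqrt]
    field_simp
  have hexp (x : ℝ) : (u + √(c * w) * x) / c * y - c * ((u + √(c * w) * x) / c) ^ 2 / 2 =
      (u * y - u ^ 2 / 2) / c + (b * x - w * x ^ 2 / 2) := by
    rw [hb]
    field_simp
    linear_combination -x ^ 2 * hsqrt
  simp only [hexp, Real.exp_add, ENNReal.ofReal_mul (Real.exp_nonneg _)]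
  rw [lintegral_const_mul' _ _ ENNReal.ofReal_ne_top, lintegral_exp_sub_sq_gaussianReal b hw,
    mul_left_comm, ← ENNReal.ofReal_mul hw1.le, mul_div_cancel₀ _ hw1.ne',
    ← ENNReal.ofReal_mul (Real.exp_nonneg _), ← Real.exp_add, hbsq]
  congr 2
  field_simp
  ring

/-- Averaging the bound `E[exp (l y - c l² / 2)] ≤ 1` over the Gaussian tilt
`l = (u + √(c w) x) / c` completes the square to the self-normalized exponent. -/
theorem lintegral_exp_quadratic_le {ν : Measure ℝ} [IsProbabilityMeasure ν] {c : NNReal}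
    (hc : 0 < c) (hν : HasSubgaussianMGF id c ν) (u : ℝ) {w : ℝ} (hw : 0 ≤ w) :
    ∫⁻ y, ENNReal.ofReal (Real.exp ((2 * y * u + y ^ 2 * w - u ^ 2) / (1 + w) / (2 * c))) ∂ν ≤
      ENNReal.ofReal √(1 + w) := by
  let l (x : ℝ) : ℝ := (u + √(c * w) * x) / c
  have htilt (x : ℝ) :
      ∫⁻ y, ENNReal.ofReal (Real.exp (l x * y - c * l x ^ 2 / 2)) ∂ν ≤ 1 := by
    simp only [Real.exp_sub, div_eq_mul_inv (Real.exp _), mul_comm (Real.exp _),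
      ENNReal.ofReal_mul (inv_nonneg.2 (Real.exp_nonneg _))]
    rw [lintegral_const_mul' _ _ ENNReal.ofReal_ne_top]
    refine (mul_le_mul_right (lintegral_exp_mul_le hν (l x)) _).trans_eq ?_
    rw [← ENNReal.ofReal_mul (by positivity), inv_mul_cancel₀ (Real.exp_ne_zero _),
      ENNReal.ofReal_one]
  simp_rw [← lintegral_exp_tilt_gaussianReal (NNReal.coe_pos.2 hc) u _ hw]
  rw [lintegral_const_mul' _ _ ENNReal.ofReal_ne_top, lintegral_lintegral_swap (by fun_prop)]
  exact mul_le_of_le_one_right' ((lintegral_mono htilt).trans_eq (by simp))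

end MethodOfMixtures

/-- `ε` is sub-Gaussian with variance proxy `c` conditionally on `m`. Mathlib's
`HasCondSubgaussianMGF` expresses this through `condExpKernel`, hence only on standard Borel spaces;
here the conditional moment generating function is a conditional expectation. -/
structure IsCondSubgaussian {Ω : Type*} (m : MeasurableSpace Ω) {mΩ : MeasurableSpace Ω} (ε : Ω → ℝ)
    (c : NNReal) (P : Measure Ω) : Prop where
  integrable_exp_mul : ∀ l : ℝ, Integrable (fun ω => Real.exp (l * ε ω)) P
  condExp_exp_mul_le : ∀ l : ℝ,
    P[fun ω => Real.exp (l * ε ω) | m] ≤ᵐ[P] fun _ => Real.exp (c * l ^ 2 / 2)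

namespace IsCondSubgaussian

variable {Ω : Type*} {mΩ : MeasurableSpace Ω} {P : Measure Ω} [IsProbabilityMeasure P] {ε : Ω → ℝ}
  {c : NNReal}

theorem hasSubgaussianMGF {m : MeasurableSpace Ω} (hm : m ≤ mΩ) (h : IsCondSubgaussian m ε c P) :
    HasSubgaussianMGF ε c P where
  integrable_exp_mul := h.integrable_exp_mul
  mgf_le l := by
    rw [mgf, ← integral_condExp hm]
    simpa using integral_mono_ae integrable_condExp (integrable_const _) (h.condExp_exp_mul_le l)

theorem hasSubgaussianMGF_condDistrib {β : Type*} [mβ : MeasurableSpace β] {X : Ω → β}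
    (h : IsCondSubgaussian (mβ.comap X) ε c P) (hX : Measurable X) (hε : Measurable ε) :
    Kernel.HasSubgaussianMGF id c (condDistrib ε X P) (P.map X) := by
  refine .of_rat (fun l => ?_) fun q => ?_
  · rw [condDistrib_comp_map hX.aemeasurable hε.aemeasurable,
      integrable_map_measure (by fun_prop) hε.aemeasurable]
    exact h.integrable_exp_mul l
  · have hmgf : Measurable fun b => mgf id (condDistrib ε X P b) q :=
      (StronglyMeasurable.integral_condDistrib (f := fun p : β × ℝ => Real.exp (q * p.2))
        (Measurable.stronglyMeasurable (by fun_prop))).measurable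
    rw [ae_map_iff hX.aemeasurable (measurableSet_le hmgf measurable_const)]
    have hcond := condExp_ae_eq_integral_condDistrib hX hε.aemeasurable
      (f := fun y : ℝ => Real.exp (q * y)) (Measurable.stronglyMeasurable (by fun_prop))
      (h.integrable_exp_mul q)
    filter_upwards [hcond, h.condExp_exp_mul_le q] with ω hω hle
    rwa [hω] at hle

theorem lintegral_comp_mul_exp_quadratic_le {β : Type*} [mβ : MeasurableSpace β] {X : Ω → β}
    (h : IsCondSubgaussian (mβ.comap X) ε c P) (hX : Measurable X) (hε : Measurable ε) (hc : 0 < c)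
    {u w : β → ℝ} (hu : Measurable u) (hw : Measurable w) (hw0 : ∀ b, 0 ≤ w b)
    {F : β → ENNReal} (hF : Measurable F) :
    ∫⁻ ω, F (X ω) * ENNReal.ofReal (Real.exp
        ((2 * ε ω * u (X ω) + ε ω ^ 2 * w (X ω) - u (X ω) ^ 2) / (1 + w (X ω)) / (2 * c))) ∂P ≤
      ∫⁻ ω, F (X ω) * ENNReal.ofReal √(1 + w (X ω)) ∂P := by
  let G (p : β × ℝ) : ENNReal := F p.1 * ENNReal.ofReal (Real.exp
    ((2 * p.2 * u p.1 + p.2 ^ 2 * w p.1 - u p.1 ^ 2) / (1 + w p.1) / (2 * c)))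
  have hG : Measurable G := by fun_prop
  have hdisint : ∫⁻ ω, G (X ω, ε ω) ∂P =
      ∫⁻ b, ∫⁻ y, G (b, y) ∂(condDistrib ε X P b) ∂(P.map X) := by
    rw [← Measure.lintegral_compProd hG, compProd_map_condDistrib hε.aemeasurable,
      lintegral_map hG (hX.prodMk hε)]
  refine hdisint.trans_le ?_
  rw [← lintegral_map (f := fun b => F b * ENNReal.ofReal √(1 + w b)) (by fun_prop) hX]
  have hcond := h.hasSubgaussianMGF_condDistrib hX hε
  refine lintegral_mono_ae ?_
  filter_upwards [hcond.mgf_le, hcond.ae_forall_integrable_exp_mul] with b hle hint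
  simp only [G]
  rw [lintegral_const_mul _ (by fun_prop)]
  gcongr
  exact lintegral_exp_quadratic_le hc ⟨hint, hle⟩ (u b) (hw0 b)

theorem lintegral_mul_exp_quadratic_le {m : MeasurableSpace Ω} (h : IsCondSubgaussian m ε c P)
    (hm : m ≤ mΩ) (hε : Measurable[mΩ] ε) (hc : 0 < c) {u w : Ω → ℝ}
    (hu : Measurable[m] u) (hw : Measurable[m] w) (hw0 : ∀ ω, 0 ≤ w ω) {F : Ω → ENNReal}
    (hF : Measurable[m] F) :
    ∫⁻ ω, F ω * ENNReal.ofReal (Real.exp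
        ((2 * ε ω * u ω + ε ω ^ 2 * w ω - u ω ^ 2) / (1 + w ω) / (2 * c))) ∂P ≤
      ∫⁻ ω, F ω * ENNReal.ofReal √(1 + w ω) ∂P :=
  lintegral_comp_mul_exp_quadratic_le (mβ := m) (X := id) (MeasurableSpace.comap_id ▸ h)
    (measurable_id'' hm) hε hc hu hw hw0 hF

end IsCondSubgaussian

section VilleInequality

variable {Ω : Type*} {mΩ : MeasurableSpace Ω} {P : Measure Ω} {ℱ : Filtration ℕ mΩ} {T : ℕ}
  {M : ℕ → Ω → ENNReal}

open Classical in
/-- The process `M` stopped at the first time it exceeds the level `K`. -/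
noncomputable def stoppedAbove (M : ℕ → Ω → ENNReal) (K : ENNReal) : ℕ → Ω → ENNReal
  | 0 => M 0
  | t + 1 => fun ω => if K < stoppedAbove M K t ω then stoppedAbove M K t ω else M (t + 1) ω

theorem stoppedAbove_eq_or_lt (M : ℕ → Ω → ENNReal) (K : ENNReal) (t : ℕ) (ω : Ω) :
    (stoppedAbove M K t ω = M t ω ∧ ∀ s < t, M s ω ≤ K) ∨ K < stoppedAbove M K t ω := by
  induction t with
  | zero => exact Or.inl ⟨rfl, by simp⟩
  | succ t ih =>
    by_cases hK : K < stoppedAbove M K t ω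
    · exact Or.inr (hK.trans_eq (if_pos hK).symm)
    · obtain ⟨heq, hle⟩ := ih.resolve_right hK
      refine Or.inl ⟨if_neg hK, fun s hs => ?_⟩
      rcases Nat.lt_succ_iff_lt_or_eq.1 hs with hs | rfl
      exacts [hle s hs, heq ▸ not_lt.1 hK]

theorem lt_stoppedAbove_of_lt {K : ENNReal} {s t : ℕ} (hst : s ≤ t) {ω : Ω} (h : K < M s ω) :
    K < stoppedAbove M K t ω := by
  refine (stoppedAbove_eq_or_lt M K t ω).elim (fun ⟨heq, hle⟩ => ?_) id
  rcases hst.lt_or_eq with hst | rfl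
  exacts [absurd h (hle s hst).not_gt, heq ▸ h]

theorem measurable_stoppedAbove (hM : ∀ t ≤ T, Measurable[ℱ t] (M t)) (K : ENNReal) {t : ℕ}
    (ht : t ≤ T) : Measurable[ℱ t] (stoppedAbove M K t) := by
  induction t with
  | zero => exact hM 0 ht
  | succ t ih =>
    have hstopped := (ih (by lia)).mono (ℱ.mono t.le_succ) le_rfl
    exact Measurable.ite (measurableSet_lt measurable_const hstopped) hstopped (hM (t + 1) ht)

theorem lintegral_stoppedAbove_le (hM : ∀ t ≤ T, Measurable[ℱ t] (M t))
    (hsuper : ∀ t < T, ∀ A, MeasurableSet[ℱ t] A → ∫⁻ ω in A, M (t + 1) ω ∂P ≤ ∫⁻ ω in A, M t ω ∂P)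
    (K : ENNReal) {t : ℕ} (ht : t ≤ T) : ∫⁻ ω, stoppedAbove M K t ω ∂P ≤ ∫⁻ ω, M 0 ω ∂P := by
  induction t with
  | zero => exact le_rfl
  | succ t ih =>
    refine le_trans ?_ (ih (by lia))
    have hA : MeasurableSet[ℱ t] {ω | K < stoppedAbove M K t ω} :=
      measurableSet_lt measurable_const (measurable_stoppedAbove hM K (by lia))
    have hA' := ℱ.le t _ hA
    rw [← lintegral_add_compl _ hA', ← lintegral_add_compl (stoppedAbove M K t) hA']
    refine add_le_add (setLIntegral_mono' hA' fun ω hω => (if_pos hω).le) ?_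
    calc ∫⁻ ω in {ω | K < stoppedAbove M K t ω}ᶜ, stoppedAbove M K (t + 1) ω ∂P
        = ∫⁻ ω in {ω | K < stoppedAbove M K t ω}ᶜ, M (t + 1) ω ∂P :=
          setLIntegral_congr_fun hA'.compl fun ω hω => if_neg hω
      _ ≤ ∫⁻ ω in {ω | K < stoppedAbove M K t ω}ᶜ, M t ω ∂P := hsuper t (by lia) _ hA.compl
      _ = ∫⁻ ω in {ω | K < stoppedAbove M K t ω}ᶜ, stoppedAbove M K t ω ∂P :=
          setLIntegral_congr_fun hA'.compl fun ω hω =>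
            ((stoppedAbove_eq_or_lt M K t ω).resolve_right hω).1.symm

theorem measure_lt_lt_inv {f : Ω → ENNReal} (hf : Measurable f) (hint : ∫⁻ ω, f ω ∂P ≤ 1)
    [IsFiniteMeasure P] {K : ENNReal} (hK : K ≠ ⊤) : P {ω | K < f ω} < K⁻¹ := by
  by_cases hP : P {ω | K < f ω} = 0
  · exact hP ▸ ENNReal.inv_pos.2 hK
  · have hlt : ∫⁻ _ in {ω | K < f ω}, K ∂P < ∫⁻ ω in {ω | K < f ω}, f ω ∂P := by
      refine setLIntegral_strict_mono (measurableSet_lt measurable_const hf) hP hf ?_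
        (ae_of_all _ fun ω hω => hω)
      rw [setLIntegral_const]
      exact ENNReal.mul_ne_top hK (measure_ne_top _ _)
    rw [setLIntegral_const] at hlt
    rw [← one_div, ENNReal.lt_div_iff_mul_lt (Or.inr (measure_ne_top _ _)) (Or.inl hK), mul_comm]
    exact hlt.trans_le ((setLIntegral_le_lintegral _ _).trans hint)

theorem measure_exists_lt_lt_inv [IsFiniteMeasure P] (hM : ∀ t ≤ T, Measurable[ℱ t] (M t))
    (hM0 : ∫⁻ ω, M 0 ω ∂P ≤ 1)
    (hsuper : ∀ t < T, ∀ A, MeasurableSet[ℱ t] A → ∫⁻ ω in A, M (t + 1) ω ∂P ≤ ∫⁻ ω in A, M t ω ∂P)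
    {K : ENNReal} (hK : K ≠ ⊤) : P {ω | ∃ t ≤ T, K < M t ω} < K⁻¹ := by
  have hsub : {ω | ∃ t ≤ T, K < M t ω} ⊆ {ω | K < stoppedAbove M K T ω} :=
    fun _ ⟨_, ht, hω⟩ => lt_stoppedAbove_of_lt ht hω
  refine (measure_mono hsub).trans_lt ?_
  exact measure_lt_lt_inv ((measurable_stoppedAbove hM K le_rfl).mono (ℱ.le T) le_rfl)
    ((lintegral_stoppedAbove_le hM hsuper K le_rfl).trans hM0) hK

end VilleInequality

section Measurability

variable {Ω : Type*} {d : ℕ} {m : MeasurableSpace Ω} {a : ℕ → Ω → Vec d} {ε : ℕ → Ω → ℝ} {t : ℕ}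

theorem measurable_covInv (ha : ∀ s < t, Measurable (a (s + 1))) {x : Ω → Vec d}
    (hx : Measurable x) : Measurable fun ω => covInv 1 (fun s => a s ω) t (x ω) := by
  induction t generalizing x with
  | zero => simpa only [covInv_zero one_pos, inv_one, one_smul, LinearMap.id_apply] using hx
  | succ t ih =>
    have hVx := ih (fun s hs => ha s (hs.trans t.lt_succ_self)) hx
    have hVa := ih (fun s hs => ha s (hs.trans t.lt_succ_self)) (ha t t.lt_succ_self)
    have hat := ha t t.lt_succ_self
    simp only [covInv_succ one_pos, LinearMap.sub_apply, LinearMap.smul_apply,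
      ContinuousLinearMap.coe_coe, InnerProductSpace.rankOne_apply]
    fun_prop

theorem measurable_noiseSum (ha : ∀ s < t, Measurable (a (s + 1)))
    (hε : ∀ s < t, Measurable (ε (s + 1))) :
    Measurable fun ω => noiseSum (fun s => a s ω) (fun s => ε s ω) t := by
  induction t with
  | zero => simp [noiseSum]
  | succ t ih =>
    have hat := ha t t.lt_succ_self
    have hεt := hε t t.lt_succ_self
    have hsum := ih (fun s hs => ha s (hs.trans t.lt_succ_self))
      (fun s hs => hε s (hs.trans t.lt_succ_self))
    simp only [noiseSum_succ]
    fun_prop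

theorem measurable_det_cov (ha : ∀ s < t, Measurable (a (s + 1))) :
    Measurable fun ω => (cov (fun s => a s ω) t).det := by
  induction t with
  | zero => simp [cov]
  | succ t ih =>
    have hdet := ih fun s hs => ha s (hs.trans t.lt_succ_self)
    have hat := ha t t.lt_succ_self
    have hVa := measurable_covInv (fun s hs => ha s (hs.trans t.lt_succ_self)) hat
    simp only [det_cov_succ]
    fun_prop

end Measurability

section Mixture

variable {d : ℕ} {c : NNReal} {a : ℕ → Vec d} {ε : ℕ → ℝ} {t : ℕ}

/-- The Gaussian mixture `exp (‖S_t‖²_{Λ_t⁻¹} / (2 c)) / √(det Λ_t)` of the exponential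
supermartingales of the noise sum `S_t`, for noise of variance proxy `c`. -/
noncomputable def mixture (c : NNReal) (a : ℕ → Vec d) (ε : ℕ → ℝ) (t : ℕ) : ℝ :=
  Real.exp (weightedNorm (covInv 1 a t) (noiseSum a ε t) ^ 2 / (2 * c)) / √(cov a t).det

theorem mixture_pos : 0 < mixture c a ε t :=
  div_pos (Real.exp_pos _) (Real.sqrt_pos.2 (det_cov_pos a t))

theorem mixture_zero : mixture c a ε 0 = 1 := by
  simp [mixture, noiseSum, weightedNorm, cov]

theorem mixture_succ (c : NNReal) (a : ℕ → Vec d) (ε : ℕ → ℝ) (t : ℕ) :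
    mixture c a ε (t + 1) =
      mixture c a ε t / √(1 + inner ℝ (a (t + 1)) (covInv 1 a t (a (t + 1)))) *
        Real.exp ((2 * ε (t + 1) * inner ℝ (a (t + 1)) (covInv 1 a t (noiseSum a ε t)) +
          ε (t + 1) ^ 2 * inner ℝ (a (t + 1)) (covInv 1 a t (a (t + 1))) -
          inner ℝ (a (t + 1)) (covInv 1 a t (noiseSum a ε t)) ^ 2) /
          (1 + inner ℝ (a (t + 1)) (covInv 1 a t (a (t + 1)))) / (2 * c)) := by
  rw [mixture, mixture, weightedNorm_noiseSum_sq_succ, det_cov_succ, add_div, Real.exp_add,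
    Real.sqrt_mul (det_cov_pos a t).le]
  ring

theorem weightedNorm_noiseSum_sq_le (hd : 1 ≤ d) (hc : 0 < c)
    (ha : ∀ s ∈ Finset.Icc 1 t, ‖a s‖ ≤ 1) {K : ℝ} (hK : mixture c a ε t ≤ K) :
    weightedNorm (covInv 1 a t) (noiseSum a ε t) ^ 2 ≤
      c * (d * Real.log (1 + t / d) + 2 * Real.log K) := by
  have : (0 : ℝ) < c := hc
  have hdet := det_cov_pos a t
  have hlog := Real.log_le_log mixture_pos hK
  rw [mixture, Real.log_div (Real.exp_pos _).ne' (Real.sqrt_pos.2 hdet).ne', Real.log_exp,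
    Real.log_sqrt hdet.le, sub_le_iff_le_add, div_le_iff₀ (by positivity)] at hlog
  calc weightedNorm (covInv 1 a t) (noiseSum a ε t) ^ 2
      ≤ (Real.log K + Real.log (cov a t).det / 2) * (2 * c) := hlog
    _ ≤ (Real.log K + d * Real.log (1 + t / d) / 2) * (2 * c) := by
      gcongr
      exact log_det_cov_le hd ha
    _ = c * (d * Real.log (1 + t / d) + 2 * Real.log K) := by ring

end Mixture

section MixtureSupermartingale

variable {Ω : Type*} {mΩ : MeasurableSpace Ω} {P : Measure Ω} {d : ℕ} {c : NNReal}
  {a : ℕ → Ω → Vec d} {ε : ℕ → Ω → ℝ} {t : ℕ}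

theorem measurable_mixture {m : MeasurableSpace Ω} (ha : ∀ s < t, Measurable[m] (a (s + 1)))
    (hε : ∀ s < t, Measurable[m] (ε (s + 1))) :
    Measurable[m] fun ω => mixture c (fun s => a s ω) (fun s => ε s ω) t := by
  have hS := measurable_noiseSum ha hε
  have hV := measurable_covInv ha hS
  have hdet := measurable_det_cov ha
  unfold mixture weightedNorm
  fun_prop

variable [IsProbabilityMeasure P]

theorem setLIntegral_mixture_succ_le {m : MeasurableSpace Ω} (hm : m ≤ mΩ) (hc : 0 < c)
    (ha : ∀ s ≤ t, Measurable[m] (a (s + 1))) (hε : ∀ s < t, Measurable[m] (ε (s + 1)))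
    (hεt : Measurable[mΩ] (ε (t + 1))) (hsub : IsCondSubgaussian m (ε (t + 1)) c P)
    {A : Set Ω} (hA : MeasurableSet[m] A) :
    ∫⁻ ω in A, ENNReal.ofReal (mixture c (fun s => a s ω) (fun s => ε s ω) (t + 1)) ∂P ≤
      ∫⁻ ω in A, ENNReal.ofReal (mixture c (fun s => a s ω) (fun s => ε s ω) t) ∂P := by
  have hat := ha t le_rfl
  have hpast (s : ℕ) (hs : s < t) := ha s hs.le
  have hVS := measurable_covInv hpast (measurable_noiseSum hpast hε)
  have hVa := measurable_covInv hpast hat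
  have hM := measurable_mixture (c := c) hpast hε
  let w (ω : Ω) : ℝ := inner ℝ (a (t + 1) ω) (covInv 1 (fun s => a s ω) t (a (t + 1) ω))
  let M (ω : Ω) : ℝ := mixture c (fun s => a s ω) (fun s => ε s ω) t
  have hw0 (ω : Ω) : 0 ≤ w ω := (covInv_isPositive one_pos).inner_nonneg_right _
  have hMw (ω : Ω) : 0 ≤ M ω / √(1 + w ω) := div_nonneg mixture_pos.le (Real.sqrt_nonneg _)
  have hw : Measurable[m] w := hat.inner hVa
  have hF : Measurable[m] (A.indicator fun ω => ENNReal.ofReal (M ω / √(1 + w ω))) :=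
    (hM.div (measurable_const.add hw).sqrt).ennreal_ofReal.indicator hA
  have hstep := hsub.lintegral_mul_exp_quadratic_le hm hεt hc (hat.inner hVS) hw hw0 hF
  rw [← lintegral_indicator (hm A hA), ← lintegral_indicator (hm A hA)]
  convert hstep using 3 with ω ω
  · by_cases hω : ω ∈ A
    · simp only [Set.indicator_of_mem hω, mixture_succ]
      exact ENNReal.ofReal_mul (hMw ω)
    · simp only [Set.indicator_of_notMem hω, zero_mul]
  · by_cases hω : ω ∈ A
    · have hw1 : √(1 + w ω) ≠ 0 := (Real.sqrt_pos.2 (by linarith [hw0 ω])).ne'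
      simp only [Set.indicator_of_mem hω, ← ENNReal.ofReal_mul (hMw ω), div_mul_cancel₀ _ hw1, M]
    · simp only [Set.indicator_of_notMem hω, zero_mul]

end MixtureSupermartingale

section SelfNormalizedBound

variable {Ω : Type*} {mΩ : MeasurableSpace Ω} {P : Measure Ω} [IsProbabilityMeasure P] {d T : ℕ}
  {c : NNReal} {a : ℕ → Ω → Vec d} {ε : ℕ → Ω → ℝ} {ℱ : Filtration ℕ mΩ} {K : ℝ}

theorem measure_exists_lt_mixture_lt (hc : 0 < c)
    (ha : ∀ t < T, Measurable[ℱ t] (a (t + 1))) (hε : ∀ t < T, Measurable[ℱ (t + 1)] (ε (t + 1)))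
    (hsub : ∀ t < T, IsCondSubgaussian (ℱ t) (ε (t + 1)) c P) (hK : 0 < K) :
    P {ω | ∃ t ≤ T, K < mixture c (fun s => a s ω) (fun s => ε s ω) t} < ENNReal.ofReal K⁻¹ := by
  have hapast {t : ℕ} (ht : t ≤ T) (s : ℕ) (hs : s < t) : Measurable[ℱ t] (a (s + 1)) :=
    (ha s (by lia)).mono (ℱ.mono hs.le) le_rfl
  have hεpast {t : ℕ} (ht : t ≤ T) (s : ℕ) (hs : s < t) : Measurable[ℱ t] (ε (s + 1)) :=
    (hε s (by lia)).mono (ℱ.mono hs) le_rfl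
  have hville := measure_exists_lt_lt_inv (P := P) (T := T)
    (M := fun t ω => ENNReal.ofReal (mixture c (fun s => a s ω) (fun s => ε s ω) t))
    (fun t ht => (measurable_mixture (hapast ht) (hεpast ht)).ennreal_ofReal)
    (by simp [mixture_zero])
    (fun t ht A hA => setLIntegral_mixture_succ_le (ℱ.le t) hc
      (fun s hs => (ha s (by lia)).mono (ℱ.mono hs) le_rfl) (hεpast ht.le)
      ((hε t ht).mono (ℱ.le _) le_rfl) (hsub t ht) hA)
    (ENNReal.ofReal_ne_top (r := K))
  simpa only [ENNReal.ofReal_lt_ofReal_iff mixture_pos, ENNReal.ofReal_inv_of_pos hK] using hville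

theorem measure_exists_lt_weightedNorm_noiseSum_sq_lt (hd : 1 ≤ d)
    (ha : ∀ t < T, Measurable[ℱ t] (a (t + 1))) (ha1 : ∀ t ∈ Finset.Icc 1 T, ∀ ω, ‖a t ω‖ ≤ 1)
    (hε : ∀ t < T, Measurable[ℱ (t + 1)] (ε (t + 1)))
    (hsub : ∀ t < T, IsCondSubgaussian (ℱ t) (ε (t + 1)) c P) (hK : 0 < K) :
    P {ω | ∃ t ≤ T, c * (d * Real.log (1 + t / d) + 2 * Real.log K) < weightedNorm
      (covInv 1 (fun s => a s ω) t) (noiseSum (fun s => a s ω) (fun s => ε s ω) t) ^ 2} <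
      ENNReal.ofReal K⁻¹ := by
  rcases eq_zero_or_pos c with rfl | hc
  · have hnoise : ∀ᵐ ω ∂P, ∀ t < T, ε (t + 1) ω = 0 := by
      simp only [ae_all_iff]
      exact fun t ht =>
        ((hsub t ht).hasSubgaussianMGF (ℱ.le t)).ae_eq_zero_of_hasSubgaussianMGF_zero
    refine (measure_eq_zero_iff_ae_notMem.2 ?_).trans_lt (ENNReal.ofReal_pos.2 (inv_pos.2 hK))
    filter_upwards [hnoise] with ω hω
    rintro ⟨t, ht, hlt⟩
    have hsum : noiseSum (fun s => a s ω) (fun s => ε s ω) t = 0 := by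
      refine Finset.sum_eq_zero fun s hs => ?_
      obtain ⟨hs1, hst⟩ := Finset.mem_Icc.1 hs
      obtain ⟨s, rfl⟩ := Nat.exists_eq_add_of_le' hs1
      simp only [hω s (by lia), zero_smul]
    simp [hsum, weightedNorm] at hlt
  · refine (measure_mono ?_).trans_lt (measure_exists_lt_mixture_lt hc ha hε hsub hK)
    rintro ω ⟨t, ht, hlt⟩
    refine ⟨t, ht, lt_of_not_ge fun hle => hlt.not_ge ?_⟩
    exact weightedNorm_noiseSum_sq_le hd hc
      (fun s hs => ha1 s (Finset.Icc_subset_Icc_right ht hs) ω) hle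

end SelfNormalizedBound

/-- LinUCB run along an arbitrary filtration `ℱ` to which the rewards are adapted, so that the
choice among the maximizers may use further randomness; of the noise only conditional
sub-Gaussianity with variance proxy `σ²` is required. -/
structure IsSubgaussianRun {Ω : Type*} {mΩ : MeasurableSpace Ω} (P : Measure Ω)
    (ℱ : Filtration ℕ mΩ) {d : ℕ} (T : ℕ) (β σ : ℝ) (θ e : Vec d) (a : ℕ → Ω → Vec d)
    (r : ℕ → Ω → ℝ) : Prop where
  predictable : ∀ t < T, Measurable[ℱ t] (a (t + 1))
  adapted : ∀ t < T, Measurable[ℱ (t + 1)] (r (t + 1))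
  action_mem : ∀ t ∈ Finset.Icc 1 T, ∀ ω, ‖a t ω‖ ≤ 1
  action_max : ∀ t ∈ Finset.Icc 1 T, ∀ ω, ∀ b : Vec d, ‖b‖ ≤ 1 →
    ucb β e (fun s => a s ω) (fun s => r s ω) t b ≤
      ucb β e (fun s => a s ω) (fun s => r s ω) t (a t ω)
  noise_subgaussian : ∀ t < T,
    IsCondSubgaussian (ℱ t) (noise θ a r (t + 1)) (σ ^ 2).toNNReal P

section History

variable {Ω : Type*} {d : ℕ} {a : ℕ → Ω → Vec d} {r : ℕ → Ω → ℝ}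

theorem hist_mono (a : ℕ → Ω → Vec d) (r : ℕ → Ω → ℝ) : Monotone (hist a r) :=
  fun _ _ hst => biSup_mono fun _ hs => Finset.Icc_subset_Icc_right hst hs

theorem measurable_reward_hist {s t : ℕ} (hs : s ∈ Finset.Icc 1 t) : Measurable[hist a r t] (r s) :=
  Measurable.of_comap_le <| le_sup_right.trans <|
    le_biSup (fun s => MeasurableSpace.comap (a s) inferInstance ⊔
      MeasurableSpace.comap (r s) inferInstance) hs

end History

namespace IsRun

variable {Ω : Type*} [mΩ : MeasurableSpace Ω] {P : Measure Ω} {d T : ℕ} {β σ : ℝ} {θ e : Vec d}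
  {a : ℕ → Ω → Vec d} {r : ℕ → Ω → ℝ}

/-- The natural filtration of the run, which is constant from the horizon `T` on because nothing is
assumed to be measurable after `T`. -/
noncomputable def filtration (h : IsRun P T β σ θ e a r) : Filtration ℕ mΩ where
  seq t := hist a r (min t T)
  mono' _ _ hst := hist_mono a r (min_le_min_right T hst)
  le' _ := iSup₂_le fun s hs =>
    have hsT := Finset.Icc_subset_Icc_right (min_le_right _ T) hs
    sup_le (h.measurable_action s hsT).comap_le (h.measurable_reward s hsT).comap_le

theorem isSubgaussianRun (h : IsRun P T β σ θ e a r) :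
    IsSubgaussianRun P h.filtration T β σ θ e a r := by
  have hfiltration {t : ℕ} (ht : t ≤ T) : h.filtration t = hist a r t :=
    congrArg (hist a r) (min_eq_left ht)
  have hmem {t : ℕ} (ht : t < T) : t + 1 ∈ Finset.Icc 1 T := Finset.mem_Icc.2 ⟨by lia, ht⟩
  refine ⟨fun t ht => ?_, fun t ht => ?_, h.action_mem, h.action_max, fun t ht => ?_⟩
  · exact hfiltration ht.le ▸ h.predictable (t + 1) (hmem ht)
  · exact hfiltration ht ▸ measurable_reward_hist (Finset.right_mem_Icc.2 (by lia))
  · refine hfiltration ht.le ▸ ⟨h.noise_exp_integrable _ (hmem ht), fun l => ?_⟩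
    simpa only [Real.coe_toNNReal _ (sq_nonneg σ), Nat.add_sub_cancel]
      using h.noise_subgaussian _ (hmem ht) l

end IsRun

section Confidence

variable {Ω : Type*} {mΩ : MeasurableSpace Ω} {P : Measure Ω} [IsProbabilityMeasure P]
  {ℱ : Filtration ℕ mΩ} {d T : ℕ} {β σ : ℝ} {θ e : Vec d} {a : ℕ → Ω → Vec d} {r : ℕ → Ω → ℝ}

namespace IsSubgaussianRun

theorem exists_weightedNorm_noiseSum_le (h : IsSubgaussianRun P ℱ T β σ θ e a r) (hd : 1 ≤ d)
    (hT : 1 ≤ T) (hσ : 0 ≤ σ) :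
    ∃ E : Set Ω, MeasurableSet E ∧ 1 - 1 / (T : ℝ) < P.real E ∧ ∀ ω ∈ E, ∀ t ≤ T,
      weightedNorm (covInv 1 (fun s => a s ω) t)
          (noiseSum (fun s => a s ω) (fun s => noise θ a r s ω) t) ≤
        σ * √(d * Real.log (1 + T / d) + 2 * Real.log T) := by
  have hT0 : (0 : ℝ) < T := by exact_mod_cast hT
  have : (0 : ℝ) < d := by exact_mod_cast hd
  have hbad := measure_exists_lt_weightedNorm_noiseSum_sq_lt hd h.predictable h.action_mem
    (fun t ht => (h.adapted t ht).sub
      (((h.predictable t ht).mono (ℱ.mono t.le_succ) le_rfl).inner measurable_const))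
    h.noise_subgaussian hT0
  set bad : Set Ω := {ω | ∃ t ≤ T, _}
  refine ⟨(toMeasurable P bad)ᶜ, (measurableSet_toMeasurable _ _).compl, ?_, fun ω hω t ht => ?_⟩
  · rw [probReal_compl_eq_one_sub (measurableSet_toMeasurable _ _), measureReal_def,
      measure_toMeasurable, one_div]
    exact sub_lt_sub_left (ENNReal.toReal_lt_of_lt_ofReal hbad) 1
  · have hle := not_lt.1 fun hlt => hω (subset_toMeasurable P bad ⟨t, ht, hlt⟩)
    rw [Real.coe_toNNReal _ (sq_nonneg σ)] at hle
    rw [← Real.sqrt_sq hσ, ← Real.sqrt_mul (sq_nonneg σ)]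
    refine Real.le_sqrt_of_sq_le (hle.trans ?_)
    gcongr

theorem exists_isOptimistic (h : IsSubgaussianRun P ℱ T β σ θ e a r) (hd : 1 ≤ d) (hT : 1 ≤ T)
    (hσ : 0 ≤ σ) (hβ : σ * √(d * Real.log (1 + T / d) + 2 * Real.log T) + 1 ≤ β)
    (hθ : ‖θ‖ = 1) (he : ‖e‖ ≤ 1) :
    ∃ E : Set Ω, MeasurableSet E ∧ 1 - 1 / (T : ℝ) < P.real E ∧
      ∀ ω ∈ E, IsOptimistic β θ (fun s => a s ω) T := by
  obtain ⟨E, hE, hPE, hconf⟩ := h.exists_weightedNorm_noiseSum_le hd hT hσ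
  refine ⟨E, hE, hPE, fun ω hω => ?_⟩
  have hβ0 : 0 ≤ β := le_trans (by positivity) hβ
  refine .of_norm_ridge_sub_le hd hβ0 hθ he (fun t ht => h.action_mem t ht ω)
    (fun t ht => h.action_max t ht ω) fun t ht => ?_
  refine (norm_ridge_sub_le hd hθ _ _ t (hconf ω hω t ht.le)).trans ?_
  gcongr

end IsSubgaussianRun

end Confidence

end LinUCB

theorem proposition2_general (κ : ℝ) (hκ : 0 < κ) :
    ∃ c > (0 : ℝ), ∃ C > (0 : ℝ),
      ∀ {Ω : Type*} [mΩ : MeasurableSpace Ω] (P : Measure Ω) [IsProbabilityMeasure P]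
        (ℱ : Filtration ℕ mΩ) (d : ℕ) (_ : 2 ≤ d) (T : ℕ) (_ : 1 ≤ T) (σ : ℝ) (_ : 0 ≤ σ) (β : ℝ)
        (_ : σ * √(d * Real.log (1 + T / d) + 2 * Real.log T) + 1 ≤ β)
        (θ : LinUCB.Vec d) (_ : ‖θ‖ = 1) (e : LinUCB.Vec d) (_ : ‖e‖ ≤ 1)
        (a : ℕ → Ω → LinUCB.Vec d) (r : ℕ → Ω → ℝ)
        (_ : LinUCB.IsSubgaussianRun P ℱ T β σ θ e a r),
        ∃ E : Set Ω, MeasurableSet E ∧ 1 - 1 / (T : ℝ) < P.real E ∧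
          ∀ ω ∈ E, ∀ t : ℕ, κ * (β ^ 2 * d) ≤ t → t ≤ T →
            LinUCB.Comparable c C (LinUCB.eig (fun s => a s ω) t d)
              (LinUCB.meanEig (fun s => a s ω) t) ∧
            LinUCB.Comparable c C (LinUCB.meanEig (fun s => a s ω) t) (β * √((t : ℝ) / d)) ∧
            ∀ v : LinUCB.Vec d, LinUCB.IsLeadingEigenvector θ (fun s => a s ω) t v →
              ‖v - θ‖ ≤ C * (β / √(LinUCB.eig (fun s => a s ω) t d)) := by
  obtain ⟨c, hc, C, hC, hspectrum⟩ := LinUCB.IsOptimistic.exists_comparable hκ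
  refine ⟨c, hc, C, hC, fun P _ ℱ d hd T hT σ hσ β hβ θ hθ e he a r hrun => ?_⟩
  obtain ⟨E, hE, hPE, hopt⟩ := hrun.exists_isOptimistic (by lia) hT hσ hβ hθ he
  have hβ1 : 1 ≤ β := (le_add_of_nonneg_left (by positivity)).trans hβ
  exact ⟨E, hE, hPE, fun ω hω t => hspectrum hd hβ1 hθ (hopt ω hω)⟩

theorem proposition2 (κ : ℝ) (hκ : 0 < κ) :
    ∃ c > (0 : ℝ), ∃ C > (0 : ℝ),
      ∀ {Ω : Type*} [MeasurableSpace Ω] (P : Measure Ω) [IsProbabilityMeasure P]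
        (d : ℕ) (_ : 2 ≤ d) (T : ℕ) (_ : 1 ≤ T) (σ : ℝ) (_ : 0 ≤ σ) (β : ℝ)
        (_ : σ * √(d * Real.log (1 + T / d) + 2 * Real.log T) + 1 ≤ β)
        (θ : LinUCB.Vec d) (_ : ‖θ‖ = 1) (e : LinUCB.Vec d) (_ : ‖e‖ ≤ 1)
        (a : ℕ → Ω → LinUCB.Vec d) (r : ℕ → Ω → ℝ) (_ : LinUCB.IsRun P T β σ θ e a r),
        ∃ E : Set Ω, MeasurableSet E ∧ 1 - 1 / (T : ℝ) < P.real E ∧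
          ∀ ω ∈ E, ∀ t : ℕ, κ * (β ^ 2 * d) ≤ t → t ≤ T →
            LinUCB.Comparable c C (LinUCB.eig (fun s => a s ω) t d)
              (LinUCB.meanEig (fun s => a s ω) t) ∧
            LinUCB.Comparable c C (LinUCB.meanEig (fun s => a s ω) t) (β * √((t : ℝ) / d)) ∧
            ∀ v : LinUCB.Vec d, LinUCB.IsLeadingEigenvector θ (fun s => a s ω) t v →
              ‖v - θ‖ ≤ C * (β / √(LinUCB.eig (fun s => a s ω) t d)) := by
  obtain ⟨c, hc, C, hC, hspectrum⟩ := proposition2_general κ hκ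
  exact ⟨c, hc, C, hC, fun P _ d hd T hT σ hσ β hβ θ hθ e he a r hrun =>
    hspectrum P hrun.filtration d hd T hT σ hσ β hβ θ hθ e he a r hrun.isSubgaussianRun⟩
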